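/- Consider the three-dimensional incompressible Navier–Stokes equations with unit viscosity, $$\partial_t u + u\cdot\nabla u + \nabla p - \Delta u = 0,\qquad \operatorname{div} u = 0 \qquad\text{on } [0,\infty)\times\mathbb R^3 .$$ For $\sigma\in\mathbb R$ and $f\in L^2(\mathbb R^3;\mathbb R^3)$ put $\|f\|_{\mathcal Y^\sigma} := \operatorname{ess\,sup}_{\xi\in\mathbb R^3} |\xi|^\sigma|\widehat f(\xi)| \in [0,\infty]$, and write $f\in L^2\cap\mathcal Y^\sigma$ if this is finite. A Leray–Hopf weak solution with initial datum $u_0\in L^2$ is a weakly continuous $u:[0,\infty)\to L^2(\mathbb R^3;\mathbb R^3)$ with $u(0)=u_0$, belonging to $L^\infty_{loc}([0,\infty);L^2)\cap L^2_{loc}([0,\infty);H^1)$, with $\operatorname{div}u(t)=0$ in the sense of distributions for every $t\ge 0$, satisfying $$\int_0^\infty\!\!\int_{\mathbb R^3} \big(u\cdot\partial_t\varphi + u\cdot\Delta\varphi + u\cdot (u\cdot\nabla)\varphi\big)\,dx\,dt + \int_{\mathbb R^3} u_0\cdot\varphi(0)\,dx = 0$$ for every divergence-free $\varphi\in C_c^\infty([0,\infty)\times\mathbb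 R^3;\mathbb R^3)$, and satisfying the energy inequality $$\|u(t)\|_{L^2}^2 + 2\int_s^t\|\nabla u(\tau)\|_{L^2}^2\,d\tau \le \|u(s)\|_{L^2}^2\qquad\text{for all } t\ge s,$$ for $s=0$ and for almost every $s>0$. **Theorem.** Let $\sigma\in[-1,1]$, let $u_0\in L^2\cap\mathcal Y^\sigma$ with $\operatorname{div}u_0=0$, and let $u$ be a Leray–Hopf weak solution with initial datum $u_0$. Then there is a constant $C_0$, depending only on $\sigma$, $\|u_0\|_{L^2}$ and $\|u_0\|_{\mathcal Y^\sigma}$, such that for all $t\ge 0$ $$\|u(t)\|_{L^2}\le C_0,\qquad \|u(t)\|_{\mathcal Y^\sigma}\le C_0,\qquad \|u(t)\|_{L^2}^2\le C_0(1+t)^{-\frac32+\sigma}.$$ -/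

import Mathlib

open MeasureTheory Set
open scoped ENNReal ContDiff FourierTransform InnerProductSpace

noncomputable section

namespace NSE

/-- Euclidean space `ℝ³`. -/
abbrev R3 : Type := EuclideanSpace ℝ (Fin 3)

/-- The complexified space `ℂ³`, in which Fourier transforms of vector fields take values. -/
abbrev C3 : Type := EuclideanSpace ℂ (Fin 3)

/-- Square integrable vector fields on `ℝ³`. -/
abbrev L2 : Type := Lp R3 2 (volume : Measure R3)

/-- The `i`-th standard basis vector of `ℝ³`. -/
def e (i : Fin 3) : R3 := EuclideanSpace.single i 1

/-- The inclusion `ℝ³ → ℂ³`. -/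
def toC3 : R3 →L[ℝ] C3 :=
  LinearMap.toContinuousLinearMap
    { toFun := fun v => WithLp.toLp 2 fun i => (v i : ℂ)
      map_add' := fun v w => by ext i; simp
      map_smul' := fun c v => by ext i; simp }

/-- The Fourier transform (Plancherel) of a square integrable vector field. -/
def hat (f : L2) : Lp C3 2 (volume : Measure R3) := 𝓕 (toC3.compLp f)

/-- The pseudo-measure norm `sup_ξ |ξ|^σ |f̂(ξ)|` of a square integrable vector field, with values
in `[0, ∞]`. As `f̂` is a class of functions, the supremum is the essential one.
The field lies in `𝒴^σ` iff this is finite. -/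
def pmNorm (σ : ℝ) (f : L2) : ℝ≥0∞ :=
  essSup (fun ξ : R3 => ‖ξ‖ₑ ^ σ * ‖hat f ξ‖ₑ) volume

/-- `g i` is the weak partial derivative `∂ᵢ f`, for each `i`. -/
def IsWeakGradient (f : L2) (g : Fin 3 → L2) : Prop :=
  ∀ i : Fin 3, ∀ φ : R3 → ℝ, ContDiff ℝ ∞ φ → HasCompactSupport φ →
    ∫ x, (fderiv ℝ φ x (e i)) • f x = -∫ x, φ x • g i x

/-- `‖∇f‖²_{L²} = ∑ᵢ ‖∂ᵢ f‖²_{L²}`, with value `∞` if `f` has no weak gradient in `L²`.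
(The weak gradient is unique, so the infimum is over at most one element.) -/
def gradNormSq (f : L2) : ℝ≥0∞ :=
  ⨅ (g : Fin 3 → L2) (_ : IsWeakGradient f g), ∑ i, ‖g i‖ₑ ^ 2

/-- `div f = 0` in the sense of distributions. -/
def WeaklyDivFree (f : L2) : Prop :=
  ∀ ψ : R3 → ℝ, ContDiff ℝ ∞ ψ → HasCompactSupport ψ → ∫ x, fderiv ℝ ψ x (f x) = 0

/-- The divergence of a differentiable vector field. -/
def divergence (v : R3 → R3) (x : R3) : ℝ := ∑ i, fderiv ℝ v x (e i) i

/-- Divergence-free test fields: restrictions of these to `t ≥ 0` are the divergence-free elements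
of `C_c^∞([0, ∞) × ℝ³; ℝ³)`. -/
structure IsTestField (φ : ℝ → R3 → R3) : Prop where
  smooth : ContDiff ℝ ∞ (Function.uncurry φ)
  compact : HasCompactSupport (Function.uncurry φ)
  divFree : ∀ t x, divergence (φ t) x = 0

/-- `u` (only its values at times `t ≥ 0` matter) is a weak solution on `[0, ∞) × ℝ³` of
`∂ₜu + u·∇u + ∇p - Δu = 0`, `div u = 0`, `u(0) = u₀`, in the energy class
`L^∞_loc([0, ∞); L²) ∩ L²_loc([0, ∞); H¹)` and weakly continuous in time. -/
structure IsWeakSolution (u₀ : L2) (u : ℝ → L2) : Prop where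
  initial : u 0 = u₀
  bounded : ∀ T : ℝ, ∃ M : ℝ, ∀ t ∈ Icc 0 T, ‖u t‖ ≤ M
  gradient : ∀ T : ℝ, ∫⁻ t in Ioc 0 T, gradNormSq (u t) < ⊤
  weakCont : ∀ w : L2, ContinuousOn (fun t => ⟪w, u t⟫_ℝ) (Ici 0)
  divFree : ∀ t, 0 ≤ t → WeaklyDivFree (u t)
  weakForm : ∀ φ : ℝ → R3 → R3, IsTestField φ →
    (∫ t in Ioi (0 : ℝ), ∫ x,
      (⟪u t x, deriv (fun s => φ s x) t⟫_ℝ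
        + ⟪u t x, Laplacian.laplacian (φ t) x⟫_ℝ
        + ⟪u t x, fderiv ℝ (φ t) x (u t x)⟫_ℝ))
      + ∫ x, ⟪u₀ x, φ 0 x⟫_ℝ = 0

/-- The energy inequality on `[s, t]` for all `t ≥ s`. -/
def EnergyInequalityFrom (u : ℝ → L2) (s : ℝ) : Prop :=
  ∀ t, s ≤ t → ‖u t‖ₑ ^ 2 + 2 * ∫⁻ τ in Ioc s t, gradNormSq (u τ) ≤ ‖u s‖ₑ ^ 2

/-- Leray–Hopf weak solutions: weak solutions which satisfy the energy inequality from the initial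
time and from almost every later time `s > 0`. -/
structure IsLerayHopf (u₀ : L2) (u : ℝ → L2) : Prop where
  weak : IsWeakSolution u₀ u
  energy : EnergyInequalityFrom u 0
  strongEnergy : ∀ᵐ s ∂(volume.restrict (Ioi (0 : ℝ))), EnergyInequalityFrom u s

end NSE

end

/-!
The proof combines Duhamel's formula in Fourier space with the Fourier splitting method.

*Duhamel.* Write `lam ξ = 4π²|ξ|²` for the symbol of `-Δ`. Testing the equation with solenoidal
fields `∂_i ψ e_j - ∂_j ψ e_i` eliminates the pressure and gives an evolution equation for the
components of the curl (`IsWeakSolution.vort_eq`). With the time dependent potentials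
`ψ = 𝓕 (e^{-(T-s) lam} θ)` the linear terms cancel (`norm_diag_le`), and the quadratic term is
bounded by `‖u‖²` times second derivatives of `ψ`. If `θ ≥ 0` runs through approximate
identities, this becomes a pointwise bound for the Fourier transform of the curl; as `û(ξ)` is
orthogonal to `ξ`, Lagrange's identity turns it into

  `|û(T, ξ)| ≤ 6 e^{-T lam} |û₀(ξ)| + 36 π |ξ| ∫₀ᵀ b(r) e^{-(T-r) lam} dr`

for every continuous `b` with `‖u(r)‖² ≤ b(r)` (`IsWeakSolution.ae_norm_hat_le`).

*Splitting.* Since `|û₀| ≤ A |ξ|^{-σ}`, this bound controls the energy at the frequencies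
`|ξ| < t^{-1/2}` by a multiple of `A² t^{-(3/2-σ)} + (∫₀ᵗ b)² t^{-5/2}`. The other frequencies are
controlled by the dissipation, so the energy inequality between a time `s` in `[t/2, 2t/3]` and `t`
gives `‖u(t)‖² ≤ ‖u(s)‖² / 27` plus the low frequency term (`exists_fourierSplitting`). Iterating
over times turns a bound on `∫₀ᵗ b` into a decay rate (`exists_decay_round`). Starting from
`b = ‖u₀‖²`, at most three rounds lead to the rate `3/2 - σ` (`exists_energy_decay`).

*Pseudo-measure norm.* With this decay inserted as `b`, the nonlinear term of the pointwise bound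
multiplied by `|ξ|^σ` is bounded by Young's inequality (`IsWeakSolution.pmNorm_le`).
-/

noncomputable section

open Filter Topology LineDeriv
open scoped SchwartzMap Laplacian

namespace NSE

/-! ### Density of real test functions among Schwartz functions -/

/-- A smooth cut-off function, equal to `1` on the ball of radius `n + 1` and supported in the ball
of radius `2 (n + 1)`. -/
def cutoff (n : ℕ) (x : R3) : ℝ :=
  (⟨1, 2, one_pos, one_lt_two⟩ : ContDiffBump (0 : R3)) ((1 / ((n : ℝ) + 1)) • x)

lemma contDiff_cutoff (n : ℕ) : ContDiff ℝ ∞ (cutoff n) := by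
  unfold cutoff
  exact (ContDiffBump.contDiff _).comp (contDiff_const_smul _)

lemma hasCompactSupport_cutoff (n : ℕ) : HasCompactSupport (cutoff n) := by
  have h : (1 / ((n : ℝ) + 1)) ≠ 0 := by positivity
  exact (ContDiffBump.hasCompactSupport _).comp_homeomorph (Homeomorph.smulOfNeZero _ h)

lemma cutoff_eq_one {n : ℕ} {x : R3} (hx : ‖x‖ ≤ n + 1) : cutoff n x = 1 := by
  unfold cutoff
  apply ContDiffBump.one_of_mem_closedBall
  have h : (0 : ℝ) < n + 1 := by positivity
  rw [mem_closedBall_zero_iff, norm_smul, Real.norm_of_nonneg (by positivity)]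
  rw [one_div, inv_mul_le_iff₀ h]
  simpa using hx

lemma exists_norm_iteratedFDeriv_cutoff_sub_one_le (i : ℕ) :
    ∃ M : ℝ, 0 ≤ M ∧ ∀ n x, ‖iteratedFDeriv ℝ i (fun y => cutoff n y - 1) x‖ ≤ M := by
  set b : ContDiffBump (0 : R3) := ⟨1, 2, one_pos, one_lt_two⟩ with hb
  have hbs : ContDiff ℝ ∞ (b : R3 → ℝ) := b.contDiff
  obtain ⟨C, hC, hC'⟩ := (b.hasCompactSupport.toSchwartzMap hbs).decay 0 i
  refine ⟨C + 1, by positivity, fun n x => ?_⟩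
  have h1 : (fun y => cutoff n y - 1) =
      fun y => (fun z => b z - 1) ((1 / ((n : ℝ) + 1)) • y) := rfl
  have hs : ContDiff ℝ i (fun z : R3 => b z - 1) :=
    (b.contDiff).sub contDiff_const
  rw [h1, iteratedFDeriv_comp_const_smul _ hs]
  have h2 : ‖iteratedFDeriv ℝ i (fun z : R3 => b z - 1) ((1 / ((n : ℝ) + 1)) • x)‖ ≤ C + 1 := by
    rw [show (fun z : R3 => b z - 1) = (b : R3 → ℝ) - fun _ => 1 from rfl,
      iteratedFDeriv_sub_apply b.contDiff.contDiffAt contDiffAt_const]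
    refine (norm_sub_le _ _).trans (add_le_add
      (by have := hC' ((1 / ((n : ℝ) + 1)) • x); rwa [pow_zero, one_mul] at this) ?_)
    rcases i with _ | i
    · simp
    · simp [iteratedFDeriv_const_of_ne]
  have h3 : ‖(1 / ((n : ℝ) + 1)) ^ i‖ ≤ 1 := by
    rw [norm_pow]
    apply pow_le_one₀ (norm_nonneg _)
    rw [Real.norm_of_nonneg (by positivity), div_le_one (by positivity)]
    linarith [n.cast_nonneg (α := ℝ)]
  calc _ ≤ _ := by simp only [norm_smul]; exact mul_le_mul h3 h2 (norm_nonneg _) zero_le_one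
    _ = _ := one_mul _

/-- Cutting off a Schwartz function approximates it in the Schwartz topology. -/
lemma tendsto_cutoff_smul {F : Type*} [NormedAddCommGroup F] [NormedSpace ℝ F] (ψ : 𝓢(R3, F)) :
    Tendsto (fun n => SchwartzMap.smulLeftCLM F (cutoff n) ψ) atTop (𝓝 ψ) := by
  rw [(schwartz_withSeminorms ℝ R3 F).tendsto_nhds]
  rintro ⟨k, l⟩ ε hε
  choose M hM0 hM using exists_norm_iteratedFDeriv_cutoff_sub_one_le
  set C : ℝ := ∑ i ∈ Finset.range (l + 1), (l.choose i : ℝ) * M i *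
    SchwartzMap.seminorm ℝ (k + 1) (l - i) ψ with hCdef
  have hC : 0 ≤ C := Finset.sum_nonneg fun i _ => by
    have := hM0 i; positivity
  have key : ∀ n : ℕ, SchwartzMap.seminorm ℝ k l (SchwartzMap.smulLeftCLM F (cutoff n) ψ - ψ)
      ≤ C / (n + 1) := by
    intro n
    have hn : (0 : ℝ) < n + 1 := by positivity
    have hg : (cutoff n).HasTemperateGrowth :=
      (hasCompactSupport_cutoff n).hasTemperateGrowth (contDiff_cutoff n)
    have hfun : ⇑(SchwartzMap.smulLeftCLM F (cutoff n) ψ - ψ) =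
        fun y => (cutoff n y - 1) • ψ y := by
      ext y
      simp [SchwartzMap.smulLeftCLM_apply_apply hg, sub_smul]
    refine SchwartzMap.seminorm_le_bound ℝ k l _ (by positivity) fun x => ?_
    rw [hfun]
    by_cases hx : ‖x‖ < n + 1
    · have : (fun y => (cutoff n y - 1) • ψ y) =ᶠ[𝓝 x] fun _ => 0 := by
        filter_upwards [(isOpen_lt continuous_norm continuous_const).mem_nhds hx] with y hy
        rw [cutoff_eq_one (le_of_lt hy)]; simp
      rw [this.iteratedFDeriv ℝ l |>.eq_of_nhds]
      have h0 : iteratedFDeriv ℝ l (fun _ : R3 => (0 : F)) x = 0 := by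
        rcases l with _ | l
        · ext; simp
        · simp
      rw [h0]; simp; positivity
    · push Not at hx
      have h1 := norm_iteratedFDeriv_smul_le (𝕜 := ℝ) (N := ∞)
        ((contDiff_cutoff n).sub contDiff_const : ContDiff ℝ ∞ fun y => cutoff n y - 1)
        (ψ.smooth ⊤) x (n := l) (mod_cast le_top)
      have h2 : ‖x‖ ^ k ≤ ‖x‖ ^ (k + 1) / (n + 1) := by
        rw [le_div_iff₀ hn, pow_succ]
        gcongr
      calc _ ≤ ‖x‖ ^ (k + 1) / (n + 1) * ∑ i ∈ Finset.range (l + 1), (l.choose i : ℝ) *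
            ‖iteratedFDeriv ℝ i (fun y => cutoff n y - 1) x‖ * ‖iteratedFDeriv ℝ (l - i) ψ x‖ := by
              gcongr
        _ ≤ _ := by
          rw [div_mul_eq_mul_div, Finset.mul_sum]
          refine div_le_div_of_nonneg_right (Finset.sum_le_sum fun i _ => ?_) hn.le
          have h3 := SchwartzMap.le_seminorm ℝ (k + 1) (l - i) ψ x
          have := hM0 i
          calc _ = (l.choose i : ℝ) * ‖iteratedFDeriv ℝ i (fun y => cutoff n y - 1) x‖ *
                (‖x‖ ^ (k + 1) * ‖iteratedFDeriv ℝ (l - i) ψ x‖) := by ring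
            _ ≤ _ := by gcongr; exact hM i n x
  have hlim : Tendsto (fun n : ℕ => C / ((n : ℝ) + 1)) atTop (𝓝 0) :=
    tendsto_const_div_atTop_nhds_zero_nat C |>.comp (tendsto_add_atTop_nat 1) |>.congr
      fun n => by simp
  filter_upwards [hlim.eventually (gt_mem_nhds hε)] with n hn
  exact (key n).trans_lt hn

/-- A real Schwartz function, regarded as a complex one. -/
def complexify (φ : 𝓢(R3, ℝ)) : 𝓢(R3, ℂ) := SchwartzMap.postcompCLM Complex.ofRealCLM φ

@[simp] lemma complexify_apply (φ : 𝓢(R3, ℝ)) (x : R3) : complexify φ x = (φ x : ℂ) := rfl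

lemma exists_complexify_add (ψ : 𝓢(R3, ℂ)) :
    ∃ φ₁ φ₂ : 𝓢(R3, ℝ), ψ = complexify φ₁ + Complex.I • complexify φ₂ ∧
      (HasCompactSupport ψ → HasCompactSupport φ₁ ∧ HasCompactSupport φ₂) := by
  refine ⟨SchwartzMap.postcompCLM Complex.reCLM ψ, SchwartzMap.postcompCLM Complex.imCLM ψ, ?_,
    fun h => ⟨h.comp_left (g := Complex.re) rfl, h.comp_left (g := Complex.im) rfl⟩⟩
  ext x
  simp only [_root_.add_apply, _root_.smul_apply, complexify_apply, smul_eq_mul]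
  rw [mul_comm]
  exact (Complex.re_add_im (ψ x)).symm

/-- Continuous linear functionals on complex Schwartz functions are determined by their values on
real valued test functions. -/
lemma ext_of_testFunctions {V : Type*} [AddCommGroup V] [Module ℂ V] [TopologicalSpace V]
    [T2Space V] (Λ : 𝓢(R3, ℂ) →ₗ[ℂ] V) (hΛ : Continuous Λ)
    (h : ∀ φ : 𝓢(R3, ℝ), HasCompactSupport φ → Λ (complexify φ) = 0) (ψ : 𝓢(R3, ℂ)) :
    Λ ψ = 0 := by
  have hlim := (hΛ.tendsto ψ).comp (tendsto_cutoff_smul ψ)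
  refine tendsto_nhds_unique hlim ?_
  have : (Λ ∘ fun n => SchwartzMap.smulLeftCLM ℂ (cutoff n) ψ) = fun _ => 0 := by
    ext n
    set χ := SchwartzMap.smulLeftCLM ℂ (cutoff n) ψ with hχ
    have hg : (cutoff n).HasTemperateGrowth :=
      (hasCompactSupport_cutoff n).hasTemperateGrowth (contDiff_cutoff n)
    have hsupp : HasCompactSupport χ := by
      rw [hχ, SchwartzMap.smulLeftCLM_apply hg]
      exact (hasCompactSupport_cutoff n).smul_right
    obtain ⟨φ₁, φ₂, hsplit, hc⟩ := exists_complexify_add χ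
    change Λ χ = 0
    rw [hsplit, map_add, map_smul, h _ (hc hsupp).1, h _ (hc hsupp).2]
    simp
  rw [this]
  exact tendsto_const_nhds

/-! ### The Fourier transform of square integrable vector fields -/

@[simp] lemma toC3_apply (v : R3) (k : Fin 3) : toC3 v k = (v k : ℂ) := rfl

lemma norm_toC3 (v : R3) : ‖toC3 v‖ = ‖v‖ := by
  simp [EuclideanSpace.norm_eq]

/-- The pairing `∫ ψ f_k` of a Schwartz function with the `k`-th component of a vector field, as a
functional of `ψ`. -/
def pair (f : L2) (k : Fin 3) : 𝓢(R3, ℂ) →ₗ[ℂ] ℂ where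
  toFun ψ := Lp.toTemperedDistribution (toC3.compLp f) ψ k
  map_add' _ _ := by rw [map_add]; rfl
  map_smul' _ _ := by rw [map_smul]; rfl

lemma continuous_pair (f : L2) (k : Fin 3) : Continuous (pair f k) :=
  (EuclideanSpace.proj (𝕜 := ℂ) k).continuous.comp
    (Lp.toTemperedDistribution (toC3.compLp f)).continuous

lemma integrable_smul_L2 {𝕜 F : Type*} [RCLike 𝕜] [NormedAddCommGroup F] [NormedSpace 𝕜 F]
    (ψ : 𝓢(R3, 𝕜)) (f : Lp F 2 (volume : Measure R3)) : Integrable fun x => ψ x • f x :=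
  memLp_one_iff_integrable.1 ((Lp.memLp f).smul (ψ.memLp 2))

lemma pair_eq_integral (f : L2) (k : Fin 3) (ψ : 𝓢(R3, ℂ)) :
    pair f k ψ = ∫ x, ψ x * (f x k : ℂ) := by
  have h := (EuclideanSpace.proj (𝕜 := ℂ) k).integral_comp_comm
    (integrable_smul_L2 ψ (toC3.compLp f))
  change (Lp.toTemperedDistribution (toC3.compLp f) ψ) k = _
  rw [Lp.toTemperedDistribution_apply]
  refine h.symm.trans (integral_congr_ae ?_)
  filter_upwards [toC3.coeFn_compLp f] with x hx
  simp [hx]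

lemma integrable_pair (f : L2) (k : Fin 3) (ψ : 𝓢(R3, ℂ)) :
    Integrable fun x => ψ x * (f x k : ℂ) := by
  have h := (EuclideanSpace.proj (𝕜 := ℂ) k).integrable_comp
    (integrable_smul_L2 ψ (toC3.compLp f))
  refine h.congr ?_
  filter_upwards [toC3.coeFn_compLp f] with x hx
  simp [hx]

lemma integrable_mul_hat (f : L2) (k : Fin 3) (θ : 𝓢(R3, ℂ)) :
    Integrable fun ξ => θ ξ * hat f ξ k :=
  (EuclideanSpace.proj (𝕜 := ℂ) k).integrable_comp (integrable_smul_L2 θ (hat f))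

/-- The Plancherel transform satisfies the multiplication formula `∫ 𝓕θ f_k = ∫ θ (𝓕f)_k`. -/
lemma pair_fourier (f : L2) (k : Fin 3) (θ : 𝓢(R3, ℂ)) :
    pair f k (𝓕 θ) = ∫ ξ, θ ξ * hat f ξ k := by
  have h := (EuclideanSpace.proj (𝕜 := ℂ) k).integral_comp_comm (integrable_smul_L2 θ (hat f))
  change (Lp.toTemperedDistribution (toC3.compLp f) (𝓕 θ)) k = _
  rw [← TemperedDistribution.fourier_apply, Lp.fourier_toTemperedDistribution_eq,
    Lp.toTemperedDistribution_apply]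
  exact h.symm

/-- Multiplication of a Schwartz function by `ξ_k`. -/
def mulCoord (k : Fin 3) : 𝓢(R3, ℂ) →L[ℂ] 𝓢(R3, ℂ) :=
  SchwartzMap.smulLeftCLM ℂ (fun ξ : R3 => (ξ k : ℂ))

lemma hasTemperateGrowth_coord (k : Fin 3) :
    (fun ξ : R3 => (ξ k : ℂ)).HasTemperateGrowth :=
  (Complex.ofRealCLM.comp (EuclideanSpace.proj (𝕜 := ℝ) k)).hasTemperateGrowth

@[simp] lemma mulCoord_apply (k : Fin 3) (θ : 𝓢(R3, ℂ)) (ξ : R3) :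
    mulCoord k θ ξ = ξ k * θ ξ := by
  simp [mulCoord, SchwartzMap.smulLeftCLM_apply_apply (hasTemperateGrowth_coord k)]

lemma inner_e (ξ : R3) (k : Fin 3) : inner ℝ ξ (e k) = ξ k := by
  simp [e, EuclideanSpace.inner_single_right]

lemma lineDeriv_fourier (θ : 𝓢(R3, ℂ)) (k : Fin 3) :
    ∂_{e k} (𝓕 θ) = 𝓕 (-(2 * Real.pi * Complex.I) • mulCoord k θ) := by
  rw [SchwartzMap.lineDerivOp_fourier_eq]
  congr 2
  ext ξ
  have h : (inner ℝ · (e k) : R3 → ℝ).HasTemperateGrowth := by fun_prop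
  rw [SchwartzMap.smulLeftCLM_apply_apply h]
  simp [inner_e]

lemma pair_lineDeriv_fourier (f : L2) (k l : Fin 3) (θ : 𝓢(R3, ℂ)) :
    pair f k (∂_{e l} (𝓕 θ)) = -(2 * Real.pi * Complex.I) * ∫ ξ, θ ξ * (ξ l * hat f ξ k) := by
  rw [lineDeriv_fourier, pair_fourier, ← integral_const_mul]
  refine integral_congr_ae (ae_of_all _ fun ξ => ?_)
  simp
  ring

lemma lineDeriv_complexify (φ : 𝓢(R3, ℝ)) (v : R3) :
    ∂_{v} (complexify φ) = complexify (∂_{v} φ) := by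
  ext x
  rw [SchwartzMap.lineDerivOp_apply_eq_fderiv, complexify_apply,
    SchwartzMap.lineDerivOp_apply_eq_fderiv]
  have h : (⇑(complexify φ)) = Complex.ofRealCLM ∘ φ := rfl
  rw [h, fderiv_comp _ Complex.ofRealCLM.differentiableAt φ.differentiableAt]
  simp

lemma pair_complexify (f : L2) (k : Fin 3) (φ : 𝓢(R3, ℝ)) :
    pair f k (complexify φ) = ((∫ x, φ x * f x k : ℝ) : ℂ) := by
  rw [pair_eq_integral, ← integral_complex_ofReal]
  simp

lemma integrable_real_pair (f : L2) (k : Fin 3) (φ : 𝓢(R3, ℝ)) :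
    Integrable fun x => φ x * f x k := by
  have h := (integrable_pair f k (complexify φ)).re
  refine h.congr (ae_of_all _ fun x => ?_)
  simp [← Complex.ofReal_mul]

/-- A locally integrable function which annihilates all Schwartz functions vanishes. -/
lemma ae_eq_zero_of_forall_integral_schwartz {h : R3 → ℂ} (hh : LocallyIntegrable h)
    (H : ∀ θ : 𝓢(R3, ℂ), ∫ ξ, θ ξ * h ξ = 0) : h =ᵐ[volume] 0 := by
  refine ae_eq_zero_of_integral_contDiff_smul_eq_zero hh fun g hg hgs => ?_
  have := H (complexify (hgs.toSchwartzMap hg))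
  simpa using this

lemma locallyIntegrable_hat (f : L2) (k : Fin 3) : LocallyIntegrable fun ξ => hat f ξ k := by
  intro x
  have h := (Lp.memLp (hat f)).locallyIntegrable one_le_two x
  obtain ⟨s, hs, hs'⟩ := h
  exact ⟨s, hs, (EuclideanSpace.proj (𝕜 := ℂ) k).integrable_comp hs'⟩

lemma locallyIntegrable_coord_mul_hat (f : L2) (k l : Fin 3) :
    LocallyIntegrable fun ξ => ((ξ l : ℝ) : ℂ) * hat f ξ k := by
  have h := (locallyIntegrable_hat f k)
  rw [← locallyIntegrableOn_univ] at h ⊢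
  refine h.continuousOn_mul (g := fun ξ : R3 => ((ξ l : ℝ) : ℂ)) ?_ isOpen_univ.isLocallyClosed
  exact (hasTemperateGrowth_coord l).1.continuous.continuousOn

/-- The Fourier transform of a solenoidal field is orthogonal to the frequency. -/
lemma WeaklyDivFree.sum_coord_mul_hat {f : L2} (hf : WeaklyDivFree f) :
    ∀ᵐ ξ, ∑ k, (ξ k : ℂ) * hat f ξ k = 0 := by
  have h0 : ∀ ψ : 𝓢(R3, ℂ), (∑ k, (pair f k).comp
      (lineDerivOpCLM ℂ 𝓢(R3, ℂ) (e k)).toLinearMap) ψ = 0 := by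
    refine ext_of_testFunctions _ ?_ fun φ hφ => ?_
    · rw [LinearMap.coe_sum, Finset.sum_fn]
      exact continuous_finsetSum _ fun k _ => (continuous_pair f k).comp
        (lineDerivOpCLM ℂ 𝓢(R3, ℂ) (e k)).continuous
    · simp only [LinearMap.sum_apply, LinearMap.coe_comp, Function.comp_def,
        ContinuousLinearMap.coe_coe, lineDerivOpCLM_apply, lineDeriv_complexify, pair_complexify]
      rw [← Complex.ofReal_sum, ← integral_finsetSum _ fun k _ => integrable_real_pair f k _]
      rw [Complex.ofReal_eq_zero, ← hf φ (φ.smooth ⊤) hφ]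
      refine integral_congr_ae (ae_of_all _ fun x => ?_)
      have hx : f x = ∑ k, f x k • e k := by
        ext j; simp [e, Pi.single_apply]
      change _ = fderiv ℝ φ x (f x)
      conv_rhs => rw [hx, map_sum]
      simp [SchwartzMap.lineDerivOp_apply_eq_fderiv, mul_comm]
  have h1 : (fun ξ : R3 => ∑ k, ((ξ k : ℝ) : ℂ) * hat f ξ k) =ᵐ[volume] 0 := by
    refine ae_eq_zero_of_forall_integral_schwartz ?_ fun θ => ?_
    · have := fun k => locallyIntegrable_coord_mul_hat f k k
      simp only [Fin.sum_univ_three]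
      exact ((this 0).add (this 1)).add (this 2)
    · have := h0 (𝓕 θ)
      simp only [LinearMap.sum_apply, LinearMap.coe_comp, Function.comp_def,
        ContinuousLinearMap.coe_coe, lineDerivOpCLM_apply, pair_lineDeriv_fourier] at this
      rw [← Finset.mul_sum, mul_eq_zero] at this
      have h2 := this.resolve_left (by simp [Real.pi_ne_zero])
      simp only [Finset.mul_sum]
      rw [integral_finsetSum]
      · exact h2
      · intro k _
        refine (integrable_mul_hat f k (mulCoord k θ)).congr (ae_of_all _ fun ξ => ?_)
        simp; ring
  exact h1

/-- Weak derivatives become multiplication by `2πi ξ_i` under the Fourier transform. -/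
lemma IsWeakGradient.hat_eq {f : L2} {g : Fin 3 → L2} (hg : IsWeakGradient f g) (i : Fin 3) :
    ∀ᵐ ξ, hat (g i) ξ = (2 * Real.pi * Complex.I * (ξ i : ℂ)) • hat f ξ := by
  have h0 : ∀ k, ∀ ψ : 𝓢(R3, ℂ), ((pair f k).comp
      (lineDerivOpCLM ℂ 𝓢(R3, ℂ) (e i)).toLinearMap + pair (g i) k) ψ = 0 := by
    intro k
    refine ext_of_testFunctions _ ?_ fun φ hφ => ?_
    · exact ((continuous_pair f k).comp
        (lineDerivOpCLM ℂ 𝓢(R3, ℂ) (e i)).continuous).add (continuous_pair (g i) k)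
    · have h := hg i φ (φ.smooth ⊤) hφ
      have hφi : Integrable fun x => φ x • g i x :=
        integrable_smul_L2 φ (g i)
      have hφi' : Integrable fun x => (fderiv ℝ φ x (e i)) • f x :=
        integrable_smul_L2 (∂_{e i} φ) f
      have h' := congrArg (fun v : R3 => EuclideanSpace.proj (𝕜 := ℝ) k v) h
      simp only [map_neg] at h'
      rw [← ContinuousLinearMap.integral_comp_comm _ hφi,
        ← ContinuousLinearMap.integral_comp_comm _ hφi'] at h'
      simp only [LinearMap.add_apply, LinearMap.coe_comp, Function.comp_def,
        ContinuousLinearMap.coe_coe, lineDerivOpCLM_apply, lineDeriv_complexify, pair_complexify]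
      rw [← Complex.ofReal_add, Complex.ofReal_eq_zero]
      simp only [SchwartzMap.lineDerivOp_apply_eq_fderiv]
      simp only [map_smul, PiLp.proj_apply, smul_eq_mul] at h'
      rw [h']; simp
  have h1 : ∀ k, (fun ξ : R3 => hat (g i) ξ k - 2 * Real.pi * Complex.I *
      ((ξ i : ℂ) * hat f ξ k)) =ᵐ[volume] 0 := by
    intro k
    refine ae_eq_zero_of_forall_integral_schwartz ?_ fun θ => ?_
    · exact (locallyIntegrable_hat _ _).sub
        ((locallyIntegrable_coord_mul_hat f k i).smul (2 * Real.pi * Complex.I))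
    · have := h0 k (𝓕 θ)
      simp only [LinearMap.add_apply, LinearMap.coe_comp, Function.comp_def,
        ContinuousLinearMap.coe_coe, lineDerivOpCLM_apply, pair_lineDeriv_fourier,
        pair_fourier] at this
      rw [neg_mul, neg_add_eq_zero, ← integral_const_mul] at this
      simp only [mul_sub]
      rw [integral_sub (integrable_mul_hat _ _ _), ← this, sub_eq_zero]
      · refine integral_congr_ae (ae_of_all _ fun ξ => ?_)
        simp; ring
      · refine ((integrable_mul_hat f k (mulCoord i θ)).const_mul
          (2 * Real.pi * Complex.I)).congr (ae_of_all _ fun ξ => ?_)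
        simp; ring
  filter_upwards [ae_all_iff.2 h1] with ξ hξ
  ext k
  have := hξ k
  simp only [Pi.zero_apply, sub_eq_zero] at this
  simp [this]; ring

lemma enorm_sq_eq_lintegral {F : Type*} [NormedAddCommGroup F]
    (f : Lp F 2 (volume : Measure R3)) : ‖f‖ₑ ^ 2 = ∫⁻ x, ‖f x‖ₑ ^ 2 := by
  rw [Lp.enorm_def, eLpNorm_eq_lintegral_rpow_enorm_toReal two_ne_zero ENNReal.ofNat_ne_top]
  rw [← ENNReal.rpow_natCast, ← ENNReal.rpow_mul]
  simp

lemma enorm_hat (f : L2) : ‖hat f‖ₑ = ‖f‖ₑ := by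
  rw [hat, ← ofReal_norm, Lp.norm_fourier_eq, ofReal_norm, Lp.enorm_def,
    Lp.enorm_def]
  refine eLpNorm_congr_norm_ae ?_
  filter_upwards [toC3.coeFn_compLp f] with x hx
  rw [hx, norm_toC3]

lemma norm_hat (f : L2) : ‖hat f‖ = ‖f‖ := by
  rw [← toReal_enorm, ← toReal_enorm, enorm_hat]

/-- The symbol `4π²|ξ|²` of `-Δ`. -/
def lam (ξ : R3) : ℝ := (2 * Real.pi * ‖ξ‖) ^ 2

/-- The Dirichlet energy dominates its Fourier expression. (They are equal.) -/
lemma lintegral_lam_mul_hat_le_gradNormSq (f : L2) :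
    ∫⁻ ξ, ENNReal.ofReal (lam ξ) * ‖hat f ξ‖ₑ ^ 2 ≤ gradNormSq f := by
  refine le_iInf₂ fun g hg => le_of_eq ?_
  simp_rw [← enorm_hat (g _), enorm_sq_eq_lintegral]
  rw [← lintegral_finsetSum' _ fun i _ => ((Lp.aestronglyMeasurable _).enorm.pow_const 2)]
  refine lintegral_congr_ae ?_
  filter_upwards [ae_all_iff.2 hg.hat_eq] with ξ hξ
  simp only [hξ, enorm_smul, mul_pow]
  rw [← Finset.sum_mul]
  congr 1
  have : ∀ i, ‖(2 * Real.pi * Complex.I * (ξ i : ℂ))‖ₑ ^ 2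
      = ENNReal.ofReal ((2 * Real.pi) ^ 2 * (ξ i) ^ 2) := by
    intro i
    rw [← ofReal_norm, ← ENNReal.ofReal_pow (norm_nonneg _)]
    congr 1
    simp [abs_of_pos Real.pi_pos, mul_pow]
  simp only [← mul_pow, this]
  rw [← ENNReal.ofReal_sum_of_nonneg fun i _ => by positivity, lam, mul_pow,
    EuclideanSpace.norm_sq_eq, Finset.mul_sum]
  simp [mul_pow]

/-! ### Curves in Hilbert space and weak time derivatives -/

/-- A weakly continuous curve in a separable Hilbert space is strongly measurable: it is the
pointwise limit of its (continuous) projections to an increasing sequence of finite dimensional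
subspaces with dense union. -/
lemma aestronglyMeasurable_of_weakly_continuousOn {H : Type*} [NormedAddCommGroup H]
    [InnerProductSpace ℝ H] [CompleteSpace H] [TopologicalSpace.SeparableSpace H]
    {u : ℝ → H} {s : Set ℝ} (hs : MeasurableSet s)
    (hu : ∀ w : H, ContinuousOn (fun t => ⟪w, u t⟫_ℝ) s) :
    AEStronglyMeasurable u (volume.restrict s) := by
  let U : ℕ → Submodule ℝ H := fun n =>
    Submodule.span ℝ ((TopologicalSpace.denseSeq H) '' (Finset.range n : Set ℕ))
  have hfin : ∀ n, FiniteDimensional ℝ (U n) := fun n =>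
    FiniteDimensional.span_of_finite ℝ ((Finset.finite_toSet _).image _)
  have hmono : Monotone U := fun m n hmn =>
    Submodule.span_mono (image_mono (by simpa using hmn))
  have hdense : ⊤ ≤ (⨆ n, U n).topologicalClosure := by
    intro x _
    refine closure_mono (s := range (TopologicalSpace.denseSeq H)) ?_
      (TopologicalSpace.denseRange_denseSeq H x)
    rintro _ ⟨n, rfl⟩
    exact Submodule.mem_iSup_of_mem (n + 1) (Submodule.subset_span ⟨n, by simp, rfl⟩)
  refine aestronglyMeasurable_of_tendsto_ae atTop (f := fun n t => (U n).starProjection (u t))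
    (fun n => ?_) (ae_of_all _ fun t =>
      Submodule.starProjection_tendsto_self U hmono (u t) hdense)
  refine ContinuousOn.aestronglyMeasurable ?_ hs
  rw [(stdOrthonormalBasis ℝ (U n)).starProjection_eq_sum_rankOne]
  simp only [_root_.sum_apply, InnerProductSpace.rankOne_apply]
  exact continuousOn_finsetSum _ fun i _ => (hu _).smul continuousOn_const

/-- The du Bois-Reymond lemma on `[0, ∞)`, with the initial value built into the weak
formulation. -/
lemma eq_add_integral_of_weak_deriv {a g : ℝ → ℝ} (ha : ContinuousOn a (Ici 0))
    (hg : ∀ T, 0 ≤ T → IntervalIntegrable g volume 0 T)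
    (h : ∀ η : ℝ → ℝ, ContDiff ℝ ∞ η → HasCompactSupport η →
      (∫ t in Ioi (0 : ℝ), (deriv η t * a t + η t * g t)) + η 0 * a 0 = 0) {t : ℝ} (ht : 0 ≤ t) :
    a t = a 0 + ∫ s in (0 : ℝ)..t, g s := by
  set G : ℝ → ℝ := fun t => ∫ s in (0 : ℝ)..t, g s with hG
  have hGc : ContinuousOn G (Ici 0) := by
    intro x hx
    have h1 := intervalIntegral.continuousOn_primitive_interval'
      (hg (x + 1) (by simp at hx; linarith))
      (left_mem_uIcc)
    rw [uIcc_of_le (by simp at hx; linarith)] at h1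
    refine (h1 x ⟨hx, by linarith⟩).mono_of_mem_nhdsWithin ?_
    exact mem_nhdsWithin.2 ⟨Iio (x + 1), isOpen_Iio, by simp, fun y hy => ⟨hy.2, hy.1.le⟩⟩
  have hcont : ContinuousOn (fun t => a t - a 0 - G t) (Ici 0) :=
    (ha.sub continuousOn_const).sub hGc
  have key : ∀ κ : ℝ → ℝ, ContDiff ℝ ∞ κ → HasCompactSupport κ → tsupport κ ⊆ Ioi 0 →
      ∫ t, κ t • (a t - a 0 - G t) = 0 := by
    intro κ hκ hκs hκ0
    obtain ⟨R, hR0, hR⟩ : ∃ R : ℝ, 0 < R ∧ ∀ t, R ≤ t → κ t = 0 := by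
      obtain ⟨R, hR⟩ := hκs.isCompact.isBounded.subset_closedBall 0
      refine ⟨max R 0 + 1, by positivity, fun t ht => ?_⟩
      by_contra hne
      have := hR (subset_tsupport _ hne)
      rw [mem_closedBall_zero_iff, Real.norm_eq_abs] at this
      have := le_abs_self t
      have := le_max_left R 0
      linarith
    have hκ0' : ∀ t ≤ 0, κ t = 0 := fun t ht => by
      by_contra hne
      have := hκ0 (subset_tsupport _ hne)
      simp at this; linarith
    -- the primitive of `κ` vanishing at `+∞`, which is the time profile to test with on `[0, ∞)`
    set K : ℝ → ℝ := fun t => ∫ s in R..t, κ s with hK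
    have hKd : ∀ t, HasDerivAt K (κ t) t := fun t =>
      intervalIntegral.integral_hasDerivAt_right (hκ.continuous.intervalIntegrable _ _)
        (hκ.continuous.stronglyMeasurableAtFilter _ _) hκ.continuous.continuousAt
    have hKderiv : deriv K = κ := funext fun t => (hKd t).deriv
    have hKs : ContDiff ℝ ∞ K := by
      rw [contDiff_infty_iff_deriv]
      exact ⟨fun t => (hKd t).differentiableAt, by rwa [hKderiv]⟩
    have hKR : ∀ t, R ≤ t → K t = 0 := fun t ht => by
      rw [hK]
      refine intervalIntegral.integral_zero_ae (ae_of_all _ fun s hs => hR s ?_)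
      rw [uIoc_of_le ht] at hs
      exact hs.1.le
    let χ : ContDiffBump (0 : ℝ) := ⟨R + 1, R + 2, by positivity, by linarith⟩
    have hχ : ∀ t, 0 ≤ t → t < R + 1 → ∀ᶠ s in 𝓝 t, χ s = 1 := fun t h0 ht =>
      χ.eventuallyEq_one_of_mem_ball (by simp [abs_of_nonneg h0, χ]; exact ht)
    have hη : ∀ t, 0 ≤ t → K t * χ t = K t := fun t h0 => by
      by_cases ht : t < R + 1
      · rw [(hχ t h0 ht).self_of_nhds, mul_one]
      · rw [hKR t (by linarith), zero_mul]
    have hη' : ∀ t, 0 < t → deriv (fun t => K t * χ t) t = κ t := fun t h0 => by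
      have : (fun t => K t * χ t) =ᶠ[𝓝 t] K := by
        filter_upwards [lt_mem_nhds h0] with s hs
        exact hη s hs.le
      rw [this.deriv_eq, hKderiv]
    have h1 := h (fun t => K t * χ t) (hKs.mul χ.contDiff) χ.hasCompactSupport.mul_left
    rw [hη 0 le_rfl] at h1
    have h2 : ∫ t in Ioi (0 : ℝ), (deriv (fun t => K t * χ t) t * a t + (K t * χ t) * g t)
        = ∫ t in (0 : ℝ)..R, (κ t * a t + K t * g t) := by
      rw [intervalIntegral.integral_of_le hR0.le]
      rw [setIntegral_congr_fun (g := fun t => κ t * a t + K t * g t) measurableSet_Ioi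
        fun t ht => by simp only [hη' t ht, hη t (le_of_lt ht)]]
      refine setIntegral_eq_of_subset_of_forall_sdiff_eq_zero measurableSet_Ioi
        Ioc_subset_Ioi_self fun t ht => ?_
      have : R ≤ t := by
        by_contra hlt
        exact ht.2 ⟨ht.1, (not_le.1 hlt).le⟩
      rw [hR t this, hKR t this]; simp
    have hii : ∀ f : ℝ → ℝ, ContinuousOn f (Ici 0) → IntervalIntegrable f volume 0 R := fun f hf =>
      ContinuousOn.intervalIntegrable (hf.mono (by rw [uIcc_of_le hR0.le]; exact fun x hx => hx.1))
    have h3 : ∫ t in (0 : ℝ)..R, (κ t * a t + K t * g t)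
        = (∫ t in (0 : ℝ)..R, κ t * a t) + ∫ t in (0 : ℝ)..R, K t * g t :=
      intervalIntegral.integral_add (hii _ (hκ.continuous.continuousOn.mul ha))
        ((hg R hR0.le).continuousOn_mul hKs.continuous.continuousOn)
    have hKac : AbsolutelyContinuousOnInterval K 0 R :=
      (hKs.contDiffOn.of_le (by simp)).absolutelyContinuousOnInterval
    have hGac : AbsolutelyContinuousOnInterval G 0 R :=
      (hg R hR0.le).absolutelyContinuousOnInterval_intervalIntegral left_mem_uIcc
    have h4 := hKac.integral_mul_deriv_eq_deriv_mul hGac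
    have h5 : ∫ t in (0 : ℝ)..R, K t * deriv G t = ∫ t in (0 : ℝ)..R, K t * g t := by
      refine intervalIntegral.integral_congr_ae ?_
      filter_upwards [(hg R hR0.le).ae_hasDerivAt_integral] with x hx hxm
      rw [(hx (uIoc_subset_uIcc hxm) 0 left_mem_uIcc).deriv]
    rw [h5, hKderiv, hKR R le_rfl, zero_mul, zero_sub] at h4
    have hG0 : G 0 = 0 := intervalIntegral.integral_same
    have hK0 : K 0 = - ∫ t in (0 : ℝ)..R, κ t := intervalIntegral.integral_symm _ _
    have h6 : ∫ t, κ t • (a t - a 0 - G t) = ∫ t in (0 : ℝ)..R, κ t * (a t - a 0 - G t) := by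
      rw [intervalIntegral.integral_of_le hR0.le]
      refine (setIntegral_eq_integral_of_forall_compl_eq_zero fun t ht => ?_).symm
      rw [mem_Ioc, not_and_or, not_lt, not_le] at ht
      rcases ht with ht | ht
      · rw [hκ0' t ht, zero_smul]
      · rw [hR t ht.le, zero_smul]
    have h7 : ∫ t in (0 : ℝ)..R, κ t * (a t - a 0 - G t)
        = (∫ t in (0 : ℝ)..R, κ t * a t) - (∫ t in (0 : ℝ)..R, κ t) * a 0
          - ∫ t in (0 : ℝ)..R, κ t * G t := by
      rw [← intervalIntegral.integral_mul_const, ← intervalIntegral.integral_sub,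
        ← intervalIntegral.integral_sub]
      · simp only [mul_sub]
      · exact (hii _ (hκ.continuous.continuousOn.mul ha)).sub
          ((hκ.continuous.intervalIntegrable _ _).mul_const _)
      · exact hii _ (hκ.continuous.continuousOn.mul hGc)
      · exact hii _ (hκ.continuous.continuousOn.mul ha)
      · exact (hκ.continuous.intervalIntegrable _ _).mul_const _
    rw [h2, h3, h4, hG0, hK0] at h1
    rw [h6, h7]
    linarith
  have hae := isOpen_Ioi.ae_eq_zero_of_integral_contDiff_smul_eq_zero
    ((hcont.mono Ioi_subset_Ici_self).locallyIntegrableOn measurableSet_Ioi) key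
  have hzero : EqOn (fun t => a t - a 0 - G t) (fun _ => 0) (Ioi 0) := by
    refine Measure.eqOn_open_of_ae_eq (μ := volume) ?_ isOpen_Ioi
      (hcont.mono Ioi_subset_Ici_self) continuousOn_const
    rw [EventuallyEq, ae_restrict_iff' measurableSet_Ioi]
    exact hae
  rcases ht.eq_or_lt with rfl | ht
  · simp
  · have := hzero ht
    simp only at this
    linarith

/-! ### Solenoidal test fields and the functionals they define -/

/-- Partial derivatives of Schwartz functions commute. -/
lemma lineDerivOp_comm {F : Type*} [NormedAddCommGroup F] [NormedSpace ℝ F] (v w : R3)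
    (φ : 𝓢(R3, F)) : ∂_{v} (∂_{w} φ) = ∂_{w} (∂_{v} φ) := by
  have h : ∀ a b : R3, ∀ x, (∂_{a} (∂_{b} φ)) x = fderiv ℝ (fderiv ℝ φ) x a b := by
    intro a b x
    rw [SchwartzMap.lineDerivOp_apply_eq_fderiv]
    have h1 : ⇑(∂_{b} φ : 𝓢(R3, F)) = fun y => fderiv ℝ φ y b := by
      ext y; rw [SchwartzMap.lineDerivOp_apply_eq_fderiv]
    have h2 : DifferentiableAt ℝ (fderiv ℝ φ) x :=
      (((φ.smooth ⊤).fderiv_right (m := 1) (by norm_cast)).differentiable one_ne_zero) x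
    rw [h1, fderiv_clm_apply h2 (differentiableAt_const b)]
    simp
  ext x
  rw [h, h]
  exact ((φ.smooth 2).contDiffAt.isSymmSndFDerivAt (by simp)).eq v w

/-- The solenoidal vector field `∂_i φ e_j - ∂_j φ e_i` with scalar potential `φ`. -/
def rotField (i j : Fin 3) : 𝓢(R3, ℝ) →L[ℝ] 𝓢(R3, R3) :=
  (SchwartzMap.postcompCLM (ContinuousLinearMap.toSpanSingleton ℝ (e j))).comp
      (lineDerivOpCLM ℝ 𝓢(R3, ℝ) (e i)) -
    (SchwartzMap.postcompCLM (ContinuousLinearMap.toSpanSingleton ℝ (e i))).comp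
      (lineDerivOpCLM ℝ 𝓢(R3, ℝ) (e j))

lemma rotField_apply (i j : Fin 3) (φ : 𝓢(R3, ℝ)) (x : R3) :
    rotField i j φ x = ∂_{e i} φ x • e j - ∂_{e j} φ x • e i := by
  simp [rotField]

lemma inner_rotField (i j : Fin 3) (φ : 𝓢(R3, ℝ)) (v x : R3) :
    ⟪v, rotField i j φ x⟫_ℝ = ∂_{e i} φ x * v j - ∂_{e j} φ x * v i := by
  rw [rotField_apply, inner_sub_right, inner_smul_right, inner_smul_right, inner_e, inner_e]

lemma lineDeriv_postcomp {F : Type*} [NormedAddCommGroup F] [NormedSpace ℝ F] (L : ℝ →L[ℝ] F)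
    (v : R3) (φ : 𝓢(R3, ℝ)) :
    ∂_{v} (SchwartzMap.postcompCLM L φ) = SchwartzMap.postcompCLM L (∂_{v} φ) := by
  ext x
  rw [SchwartzMap.lineDerivOp_apply_eq_fderiv, SchwartzMap.postcompCLM_apply,
    SchwartzMap.lineDerivOp_apply_eq_fderiv]
  have h : (⇑(SchwartzMap.postcompCLM L φ)) = L ∘ φ := rfl
  rw [h, fderiv_comp _ L.differentiableAt φ.differentiableAt]
  simp

lemma lineDeriv_rotField (i j : Fin 3) (v : R3) (φ : 𝓢(R3, ℝ)) :
    ∂_{v} (rotField i j φ) = rotField i j (∂_{v} φ) := by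
  simp only [rotField, _root_.sub_apply, ContinuousLinearMap.comp_apply, lineDerivOpCLM_apply]
  rw [← lineDerivOpCLM_apply (R := ℝ) (E := 𝓢(R3, R3)), map_sub, lineDerivOpCLM_apply,
    lineDerivOpCLM_apply, lineDeriv_postcomp, lineDeriv_postcomp, lineDerivOp_comm v,
    lineDerivOp_comm v]

lemma laplacian_rotField (i j : Fin 3) (φ : 𝓢(R3, ℝ)) :
    Δ (rotField i j φ) = rotField i j (Δ φ) := by
  rw [SchwartzMap.laplacian_eq_sum (EuclideanSpace.basisFun (Fin 3) ℝ),
    SchwartzMap.laplacian_eq_sum (EuclideanSpace.basisFun (Fin 3) ℝ), map_sum]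
  simp only [lineDeriv_rotField]

lemma eq_sum_coord_smul_e (v : R3) : v = ∑ k, v k • e k := by
  ext j; simp [e, Pi.single_apply]

lemma fderiv_rotField (i j : Fin 3) (φ : 𝓢(R3, ℝ)) (x v : R3) :
    fderiv ℝ (rotField i j φ) x v = ∑ k, v k • rotField i j (∂_{e k} φ) x := by
  conv_lhs => rw [eq_sum_coord_smul_e v, map_sum]
  refine Finset.sum_congr rfl fun k _ => ?_
  rw [map_smul, ← SchwartzMap.lineDerivOp_apply_eq_fderiv, lineDeriv_rotField]

lemma divergence_rotField (i j : Fin 3) (φ : 𝓢(R3, ℝ)) (x : R3) :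
    divergence (rotField i j φ) x = 0 := by
  have h : ∀ k, fderiv ℝ (rotField i j φ) x (e k) k =
      (if k = j then ∂_{e i} (∂_{e j} φ) x else 0) -
        if k = i then ∂_{e i} (∂_{e j} φ) x else 0 := by
    intro k
    rw [← SchwartzMap.lineDerivOp_apply_eq_fderiv, lineDeriv_rotField, rotField_apply]
    simp only [PiLp.sub_apply, PiLp.smul_apply, e, smul_eq_mul, PiLp.single_apply,
      mul_ite, mul_one, mul_zero]
    congr 1
    · split_ifs with h
      · rw [h]
      · rfl
    · split_ifs with h
      · rw [h]
        exact congrArg (fun f : 𝓢(R3, ℝ) => f x) (lineDerivOp_comm _ _ φ)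
      · rfl
  simp [divergence, h]

lemma hasCompactSupport_rotField (i j : Fin 3) {φ : 𝓢(R3, ℝ)} (hφ : HasCompactSupport φ) :
    HasCompactSupport (rotField i j φ) := by
  have h : ∀ v, HasCompactSupport (∂_{v} φ : 𝓢(R3, ℝ)) := fun v =>
    hφ.mono' ((subset_tsupport _).trans (SchwartzMap.tsupport_lineDerivOp_subset v φ))
  have : ⇑(rotField i j φ) = fun x => ∂_{e i} φ x • e j - ∂_{e j} φ x • e i :=
    funext fun x => rotField_apply i j φ x
  rw [this]
  exact ((h _).smul_right).sub ((h _).smul_right)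

/-- The bounded bilinear map `(f, g) ↦ f_k g_l` from `L² × L²` to `L¹`. -/
def coordMul (k l : Fin 3) : L2 →L[ℝ] L2 →L[ℝ] Lp ℂ 1 (volume : Measure R3) :=
  ContinuousLinearMap.holderL volume 2 2 1
    (((ContinuousLinearMap.mul ℝ ℂ).bilinearComp
      (Complex.ofRealCLM.comp (EuclideanSpace.proj k))
      (Complex.ofRealCLM.comp (EuclideanSpace.proj l))) : R3 →L[ℝ] R3 →L[ℝ] ℂ)

lemma coeFn_coordMul (k l : Fin 3) (f : L2) :
    coordMul k l f f =ᵐ[volume] fun x => ((f x k : ℂ) * (f x l : ℂ)) :=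
  ContinuousLinearMap.coeFn_holder _ f f

/-- The pairing `∫ ψ f_k f_l`, as a functional of the Schwartz function `ψ`. -/
def quad (f : L2) (k l : Fin 3) : 𝓢(R3, ℂ) →ₗ[ℂ] ℂ where
  toFun ψ := Lp.toTemperedDistribution (coordMul k l f f) ψ
  map_add' _ _ := by rw [map_add]
  map_smul' _ _ := by rw [map_smul]; rfl

lemma continuous_quad (f : L2) (k l : Fin 3) : Continuous (quad f k l) :=
  (Lp.toTemperedDistribution (coordMul k l f f)).continuous

lemma continuous_quad_left (k l : Fin 3) (ψ : 𝓢(R3, ℂ)) : Continuous fun f => quad f k l ψ := by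
  have h1 : Continuous fun f : L2 => coordMul k l f f :=
    (coordMul k l).continuous.clm_apply continuous_id
  have h2 : Continuous fun T : Lp ℂ 1 (volume : Measure R3) => Lp.toTemperedDistribution T ψ :=
    (PointwiseConvergenceCLM.evalCLM (RingHom.id ℂ) ℂ ψ).continuous.comp
      (Lp.toTemperedDistributionCLM ℂ (volume : Measure R3) 1).continuous
  exact h2.comp h1

lemma quad_eq_integral (f : L2) (k l : Fin 3) (ψ : 𝓢(R3, ℂ)) :
    quad f k l ψ = ∫ x, ψ x * ((f x k : ℂ) * (f x l : ℂ)) := by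
  change Lp.toTemperedDistribution (coordMul k l f f) ψ = _
  rw [Lp.toTemperedDistribution_apply]
  refine integral_congr_ae ?_
  filter_upwards [coeFn_coordMul k l f] with x hx
  rw [hx, smul_eq_mul]

lemma abs_coord_le_norm (v : R3) (k : Fin 3) : |v k| ≤ ‖v‖ := PiLp.norm_apply_le v k

lemma integrable_norm_sq (f : L2) : Integrable fun x => ‖f x‖ ^ 2 :=
  (memLp_two_iff_integrable_sq_norm (Lp.aestronglyMeasurable f)).1 (Lp.memLp f)

lemma norm_sq_eq_integral (f : L2) : ‖f‖ ^ 2 = ∫ x, ‖f x‖ ^ 2 := by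
  rw [← real_inner_self_eq_norm_sq, L2.inner_def]
  simp only [real_inner_self_eq_norm_sq]

lemma norm_quad_le (f : L2) (k l : Fin 3) (ψ : 𝓢(R3, ℂ)) {S : ℝ} (hS : ∀ x, ‖ψ x‖ ≤ S) :
    ‖quad f k l ψ‖ ≤ S * ‖f‖ ^ 2 := by
  rw [quad_eq_integral, norm_sq_eq_integral, ← integral_const_mul]
  refine norm_integral_le_of_norm_le ((integrable_norm_sq f).const_mul S) (ae_of_all _ fun x => ?_)
  rw [norm_mul, norm_mul, Complex.norm_real, Complex.norm_real, sq]
  have := (norm_nonneg _).trans (hS x)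
  gcongr
  · exact hS x
  · exact abs_coord_le_norm _ _
  · exact abs_coord_le_norm _ _

lemma integrable_quad_real (f : L2) (k l : Fin 3) (φ : 𝓢(R3, ℝ)) :
    Integrable fun x => φ x * (f x k * f x l) := by
  have h : Integrable fun x => (f x k * f x l : ℝ) := by
    have := (L1.integrable_coeFn (coordMul k l f f)).congr (coeFn_coordMul k l f)
    refine this.re.congr (ae_of_all _ fun x => ?_)
    simp [← Complex.ofReal_mul]
  exact h.bdd_mul φ.continuous.aestronglyMeasurable
    (ae_of_all _ fun x => SchwartzMap.norm_le_seminorm ℝ φ x)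

lemma quad_complexify (f : L2) (k l : Fin 3) (φ : 𝓢(R3, ℝ)) :
    quad f k l (complexify φ) = ((∫ x, φ x * (f x k * f x l) : ℝ) : ℂ) := by
  rw [quad_eq_integral, ← integral_complex_ofReal]
  simp

/-- The pairing of `f` with the solenoidal field `∂_i ψ e_j - ∂_j ψ e_i`, as a functional of the
potential `ψ`; up to sign this is the component `∂_i f_j - ∂_j f_i` of the curl, as a
distribution. -/
def vort (f : L2) (i j : Fin 3) : 𝓢(R3, ℂ) →ₗ[ℂ] ℂ :=
  (pair f j).comp (lineDerivOpCLM ℂ 𝓢(R3, ℂ) (e i)).toLinearMap -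
    (pair f i).comp (lineDerivOpCLM ℂ 𝓢(R3, ℂ) (e j)).toLinearMap

lemma vort_apply (f : L2) (i j : Fin 3) (ψ : 𝓢(R3, ℂ)) :
    vort f i j ψ = pair f j (∂_{e i} ψ) - pair f i (∂_{e j} ψ) := rfl

lemma continuous_vort (f : L2) (i j : Fin 3) : Continuous (vort f i j) :=
  ((continuous_pair f j).comp (lineDerivOpCLM ℂ 𝓢(R3, ℂ) (e i)).continuous).sub
    ((continuous_pair f i).comp (lineDerivOpCLM ℂ 𝓢(R3, ℂ) (e j)).continuous)

/-- The pairing `∫ f · (f · ∇) w` of the quadratic term with the solenoidal field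
`w = ∂_i ψ e_j - ∂_j ψ e_i`, as a functional of the potential `ψ`. -/
def conv (f : L2) (i j : Fin 3) : 𝓢(R3, ℂ) →ₗ[ℂ] ℂ :=
  ∑ k, ((quad f k j).comp ((lineDerivOpCLM ℂ 𝓢(R3, ℂ) (e i)).comp
      (lineDerivOpCLM ℂ 𝓢(R3, ℂ) (e k))).toLinearMap -
    (quad f k i).comp ((lineDerivOpCLM ℂ 𝓢(R3, ℂ) (e j)).comp
      (lineDerivOpCLM ℂ 𝓢(R3, ℂ) (e k))).toLinearMap)

lemma conv_apply (f : L2) (i j : Fin 3) (ψ : 𝓢(R3, ℂ)) :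
    conv f i j ψ = ∑ k, (quad f k j (∂_{e i} (∂_{e k} ψ)) - quad f k i (∂_{e j} (∂_{e k} ψ))) := by
  simp [conv]

lemma continuous_conv (f : L2) (i j : Fin 3) : Continuous (conv f i j) := by
  have : ⇑(conv f i j) = fun ψ => _ := funext fun ψ => conv_apply f i j ψ
  rw [this]
  refine continuous_finsetSum _ fun k _ => Continuous.sub ?_ ?_
  · exact (continuous_quad f k j).comp ((lineDerivOpCLM ℂ 𝓢(R3, ℂ) (e i)).continuous.comp
      (lineDerivOpCLM ℂ 𝓢(R3, ℂ) (e k)).continuous)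
  · exact (continuous_quad f k i).comp ((lineDerivOpCLM ℂ 𝓢(R3, ℂ) (e j)).continuous.comp
      (lineDerivOpCLM ℂ 𝓢(R3, ℂ) (e k)).continuous)

lemma continuous_conv_left (i j : Fin 3) (ψ : 𝓢(R3, ℂ)) : Continuous fun f => conv f i j ψ := by
  simp only [conv_apply]
  exact continuous_finsetSum _ fun k _ =>
    (continuous_quad_left k j _).sub (continuous_quad_left k i _)

lemma vort_complexify (f : L2) (i j : Fin 3) (φ : 𝓢(R3, ℝ)) :
    vort f i j (complexify φ) = ((∫ x, ⟪f x, rotField i j φ x⟫_ℝ : ℝ) : ℂ) := by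
  simp only [inner_rotField]
  rw [integral_sub (integrable_real_pair _ _ _) (integrable_real_pair _ _ _), vort_apply,
    lineDeriv_complexify, lineDeriv_complexify, pair_complexify, pair_complexify,
    Complex.ofReal_sub]

lemma integrable_conv_real (f : L2) (i j : Fin 3) (φ : 𝓢(R3, ℝ)) :
    Integrable fun x => ⟪f x, fderiv ℝ (rotField i j φ) x (f x)⟫_ℝ := by
  simp only [fderiv_rotField, inner_sum, inner_smul_right, inner_rotField]
  refine integrable_finsetSum _ fun k _ => ?_
  refine ((integrable_quad_real f k j (∂_{e i} (∂_{e k} φ))).sub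
    (integrable_quad_real f k i (∂_{e j} (∂_{e k} φ)))).congr (ae_of_all _ fun x => ?_)
  simp; ring

lemma conv_complexify (f : L2) (i j : Fin 3) (φ : 𝓢(R3, ℝ)) :
    conv f i j (complexify φ) =
      ((∫ x, ⟪f x, fderiv ℝ (rotField i j φ) x (f x)⟫_ℝ : ℝ) : ℂ) := by
  have h : ∀ x, ⟪f x, fderiv ℝ (rotField i j φ) x (f x)⟫_ℝ = ∑ k,
      (∂_{e i} (∂_{e k} φ) x * (f x k * f x j) - ∂_{e j} (∂_{e k} φ) x * (f x k * f x i)) := by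
    intro x
    simp only [fderiv_rotField, inner_sum, inner_smul_right, inner_rotField]
    exact Finset.sum_congr rfl fun k _ => by ring
  simp only [h]
  rw [integral_finsetSum _ fun k _ => ?_, conv_apply, Complex.ofReal_sum]
  swap
  · exact (integrable_quad_real f k j (∂_{e i} (∂_{e k} φ))).sub
      (integrable_quad_real f k i (∂_{e j} (∂_{e k} φ)))
  refine Finset.sum_congr rfl fun k _ => ?_
  rw [integral_sub (integrable_quad_real _ _ _ _) (integrable_quad_real _ _ _ _)]
  simp only [lineDeriv_complexify, quad_complexify, Complex.ofReal_sub]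

/-! ### The curl equation tested with Schwartz functions -/

lemma norm_pair_le (f : L2) (k : Fin 3) (χ : 𝓢(R3, ℂ)) :
    ‖pair f k χ‖ ≤ ‖f‖ ^ 2 + ‖χ.toLp 2‖ ^ 2 := by
  have hχ : Integrable fun x => ‖χ x‖ ^ 2 :=
    (memLp_two_iff_integrable_sq_norm χ.continuous.aestronglyMeasurable).1 (χ.memLp 2)
  have h2 : ‖χ.toLp 2‖ ^ 2 = ∫ x, ‖χ x‖ ^ 2 := by
    rw [← inner_self_eq_norm_sq (𝕜 := ℂ), L2.inner_def]
    have : ∫ x : R3, ⟪χ.toLp 2 volume x, χ.toLp 2 volume x⟫_ℂ = ((∫ x, ‖χ x‖ ^ 2 : ℝ) : ℂ) := by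
      rw [← integral_complex_ofReal]
      refine integral_congr_ae ?_
      filter_upwards [χ.coeFn_toLp 2] with x hx
      rw [hx, inner_self_eq_norm_sq_to_K]
      simp
    rw [this]; simp
  rw [pair_eq_integral, h2, norm_sq_eq_integral, ← integral_add (integrable_norm_sq f) hχ]
  refine norm_integral_le_of_norm_le ((integrable_norm_sq f).add hχ) (ae_of_all _ fun x => ?_)
  rw [norm_mul, Complex.norm_real, Real.norm_eq_abs]
  have h1 := abs_coord_le_norm (f x) k
  have h3 : ‖χ x‖ * |f x k| ≤ ‖χ x‖ * ‖f x‖ := by gcongr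
  nlinarith [sq_nonneg (‖f x‖ - ‖χ x‖), sq_nonneg (‖f x‖), sq_nonneg (‖χ x‖)]

lemma norm_conv_le (f : L2) (i j : Fin 3) (ψ : 𝓢(R3, ℂ)) {S : ℝ}
    (hS : ∀ k l : Fin 3, ∀ x, ‖∂_{e k} (∂_{e l} ψ) x‖ ≤ S) :
    ‖conv f i j ψ‖ ≤ 6 * S * ‖f‖ ^ 2 := by
  rw [conv_apply]
  refine (norm_sum_le _ _).trans ?_
  calc _ ≤ ∑ _k : Fin 3, (S * ‖f‖ ^ 2 + S * ‖f‖ ^ 2) := by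
        refine Finset.sum_le_sum fun k _ => (norm_sub_le _ _).trans (add_le_add ?_ ?_)
        · exact norm_quad_le f _ _ _ (hS i k)
        · exact norm_quad_le f _ _ _ (hS j k)
    _ = _ := by simp; ring

section Evolution

variable {u₀ : L2} {u : ℝ → L2}

lemma IsWeakSolution.continuousOn_pair (hu : IsWeakSolution u₀ u) (k : Fin 3) (ψ : 𝓢(R3, ℂ)) :
    ContinuousOn (fun t => pair (u t) k ψ) (Ici 0) := by
  have hreal : ∀ φ : 𝓢(R3, ℝ), ContinuousOn (fun t => pair (u t) k (complexify φ)) (Ici 0) := by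
    intro φ
    set w : 𝓢(R3, R3) := SchwartzMap.postcompCLM (ContinuousLinearMap.toSpanSingleton ℝ (e k)) φ
    have h := Complex.continuous_ofReal.comp_continuousOn (hu.weakCont (w.toLp 2))
    refine h.congr fun t _ => ?_
    simp only [pair_complexify, Function.comp]
    rw [L2.inner_def]
    congr 1
    refine integral_congr_ae ?_
    filter_upwards [w.coeFn_toLp 2] with x hx
    rw [hx]
    simp only [w, SchwartzMap.postcompCLM_apply, ContinuousLinearMap.toSpanSingleton_apply]
    rw [inner_smul_left, real_inner_comm, inner_e]
    rfl
  obtain ⟨φ₁, φ₂, hψ, -⟩ := exists_complexify_add ψ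
  have := (hreal φ₁).add ((hreal φ₂).const_smul Complex.I)
  refine this.congr fun t _ => ?_
  simp only [hψ, map_add, map_smul]
  rfl

lemma IsWeakSolution.continuousOn_vort (hu : IsWeakSolution u₀ u) (i j : Fin 3) (ψ : 𝓢(R3, ℂ)) :
    ContinuousOn (fun t => vort (u t) i j ψ) (Ici 0) :=
  (hu.continuousOn_pair j _).sub (hu.continuousOn_pair i _)

lemma IsWeakSolution.intervalIntegrable_vort (hu : IsWeakSolution u₀ u) (i j : Fin 3)
    (ψ : 𝓢(R3, ℂ)) {s t : ℝ} (hs : 0 ≤ s) (ht : 0 ≤ t) :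
    IntervalIntegrable (fun t => vort (u t) i j ψ) volume s t :=
  ((hu.continuousOn_vort i j ψ).mono fun _ hx => (le_min hs ht).trans hx.1).intervalIntegrable

lemma IsWeakSolution.aestronglyMeasurable (hu : IsWeakSolution u₀ u) :
    AEStronglyMeasurable u (volume.restrict (Ici 0)) :=
  haveI : Fact ((2 : ℝ≥0∞) ≠ ⊤) := ⟨ENNReal.ofNat_ne_top⟩
  aestronglyMeasurable_of_weakly_continuousOn measurableSet_Ici hu.weakCont

lemma exists_bound_conv (i j : Fin 3) :
    ∃ S : 𝓢(R3, ℂ) → ℝ, Continuous S ∧ ∀ f ψ, ‖conv f i j ψ‖ ≤ S ψ * ‖f‖ ^ 2 := by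
  let S : 𝓢(R3, ℂ) → ℝ := fun ψ => 6 * ∑ k, ∑ l, SchwartzMap.seminorm ℝ 0 0 (∂_{e k} (∂_{e l} ψ))
  refine ⟨S, ?_, fun f ψ => norm_conv_le f i j ψ fun k l x => ?_⟩
  · refine continuous_const.mul (continuous_finsetSum _ fun k _ =>
      continuous_finsetSum _ fun l _ => ?_)
    exact ((schwartz_withSeminorms ℝ R3 ℂ).continuous_seminorm (0, 0)).comp
      ((lineDerivOpCLM ℂ 𝓢(R3, ℂ) (e k)).continuous.comp
        (lineDerivOpCLM ℂ 𝓢(R3, ℂ) (e l)).continuous)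
  · refine (SchwartzMap.norm_le_seminorm ℝ _ x).trans ?_
    refine le_trans ?_ (Finset.single_le_sum
      (f := fun k => ∑ l, SchwartzMap.seminorm ℝ 0 0 (∂_{e k} (∂_{e l} ψ)))
      (fun k _ => Finset.sum_nonneg fun l _ => apply_nonneg _ _) (Finset.mem_univ k))
    exact Finset.single_le_sum (f := fun l => SchwartzMap.seminorm ℝ 0 0 (∂_{e k} (∂_{e l} ψ)))
      (fun l _ => apply_nonneg _ _) (Finset.mem_univ l)

lemma IsWeakSolution.aestronglyMeasurable_conv (hu : IsWeakSolution u₀ u) (i j : Fin 3)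
    (ψ : 𝓢(R3, ℂ)) : AEStronglyMeasurable (fun t => conv (u t) i j ψ) (volume.restrict (Ici 0)) :=
  (continuous_conv_left i j ψ).comp_aestronglyMeasurable hu.aestronglyMeasurable

lemma IsWeakSolution.intervalIntegrable_conv (hu : IsWeakSolution u₀ u) (i j : Fin 3)
    (ψ : 𝓢(R3, ℂ)) {s t : ℝ} (hs : 0 ≤ s) (ht : 0 ≤ t) :
    IntervalIntegrable (fun t => conv (u t) i j ψ) volume s t := by
  obtain ⟨S, -, hS⟩ := exists_bound_conv i j
  obtain ⟨M, hM⟩ := hu.bounded (max s t)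
  have hsub : uIoc s t ⊆ Ici 0 := fun x hx => ((le_min hs ht).trans_lt hx.1).le
  rw [intervalIntegrable_iff]
  refine IntegrableOn.of_bound (by simp)
    ((hu.aestronglyMeasurable_conv i j ψ).mono_set hsub) (|S ψ| * M ^ 2) ?_
  rw [ae_restrict_iff' measurableSet_uIoc]
  refine ae_of_all _ fun x hx => (hS _ _).trans ?_
  have := hM x ⟨hsub hx, hx.2⟩
  gcongr
  exact le_abs_self _

/-- The weak formulation for real potentials of compact support, integrated in time. -/
lemma IsWeakSolution.vort_complexify_eq (hu : IsWeakSolution u₀ u) (i j : Fin 3) {φ : 𝓢(R3, ℝ)}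
    (hφ : HasCompactSupport φ) {t : ℝ} (ht : 0 ≤ t) :
    vort (u t) i j (complexify φ) = vort (u 0) i j (complexify φ) +
      ∫ s in (0 : ℝ)..t, (vort (u s) i j (complexify (Δ φ)) + conv (u s) i j (complexify φ)) := by
  have h1 : ∀ s, vort (u s) i j (complexify (Δ φ)) + conv (u s) i j (complexify φ) =
      (((∫ x, ⟪u s x, rotField i j (Δ φ) x⟫_ℝ) +
        ∫ x, ⟪u s x, fderiv ℝ (rotField i j φ) x (u s x)⟫_ℝ : ℝ) : ℂ) := fun s => by
    rw [vort_complexify, conv_complexify, Complex.ofReal_add]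
  have hintC : ∀ T, 0 ≤ T → IntervalIntegrable (fun s => vort (u s) i j (complexify (Δ φ)) +
      conv (u s) i j (complexify φ)) volume 0 T := fun T hT =>
    (hu.intervalIntegrable_vort i j _ le_rfl hT).add (hu.intervalIntegrable_conv i j _ le_rfl hT)
  simp only [h1] at hintC ⊢
  rw [intervalIntegral.integral_ofReal, vort_complexify, vort_complexify, ← Complex.ofReal_add,
    Complex.ofReal_inj]
  have hre : ∀ f : L2, ∫ x, ⟪f x, rotField i j φ x⟫_ℝ = (vort f i j (complexify φ)).re := by
    intro f; rw [vort_complexify]; rfl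
  refine eq_add_integral_of_weak_deriv (a := fun t => ∫ x, ⟪u t x, rotField i j φ x⟫_ℝ) ?_ ?_ ?_ ht
  · simp only [hre]
    exact Complex.continuous_re.comp_continuousOn (hu.continuousOn_vort i j _)
  · intro T hT
    have := hintC T hT
    rw [intervalIntegrable_iff] at this ⊢
    exact this.re
  · intro η hη hηs
    set w := rotField i j φ with hw
    have hws : ContDiff ℝ ∞ w := w.smooth ⊤
    have hwc : HasCompactSupport w := hasCompactSupport_rotField i j hφ
    have htest : IsTestField fun t x => η t • w x := by
      refine ⟨?_, ?_, fun t x => ?_⟩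
      · exact (hη.comp contDiff_fst).smul (hws.comp contDiff_snd)
      · refine HasCompactSupport.intro (hηs.isCompact.prod hwc.isCompact) fun p hp => ?_
        rw [mem_prod, not_and_or] at hp
        rcases hp with hp | hp
        · simp [Function.uncurry, image_eq_zero_of_notMem_tsupport hp]
        · simp [Function.uncurry, image_eq_zero_of_notMem_tsupport hp]
      · have h := divergence_rotField i j φ x
        simp only [divergence] at h ⊢
        have : fderiv ℝ (fun x => η t • w x) x = η t • fderiv ℝ w x :=
          fderiv_const_smul w.differentiableAt (η t)
        simp only [this, _root_.smul_apply, PiLp.smul_apply, smul_eq_mul]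
        rw [← Finset.mul_sum, h, mul_zero]
    have hint : ∀ (f : L2) (χ : 𝓢(R3, ℝ)), Integrable fun x => ⟪f x, rotField i j χ x⟫_ℝ := by
      intro f χ
      simp only [inner_rotField]
      exact (integrable_real_pair f j (∂_{e i} χ)).sub (integrable_real_pair f i (∂_{e j} χ))
    have h2 := hu.weakForm _ htest
    rw [← hu.initial] at h2
    have h3 : ∀ t, ∫ x, (⟪u t x, deriv (fun s => η s • w x) t⟫_ℝ
        + ⟪u t x, Laplacian.laplacian (fun x => η t • w x) x⟫_ℝ
        + ⟪u t x, fderiv ℝ (fun x => η t • w x) x (u t x)⟫_ℝ) =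
        deriv η t * (∫ x, ⟪u t x, w x⟫_ℝ) + η t * ((∫ x, ⟪u t x, rotField i j (Δ φ) x⟫_ℝ) +
          ∫ x, ⟪u t x, fderiv ℝ w x (u t x)⟫_ℝ) := by
      intro t
      have hd : ∀ x, deriv (fun s => η s • w x) t = deriv η t • w x := fun x =>
        deriv_smul_const ((hη.differentiable (by simp)) t) (w x)
      have hl : ∀ x, Laplacian.laplacian (fun x => η t • w x) x = η t • rotField i j (Δ φ) x := by
        intro x
        rw [show (fun x => η t • w x) = η t • (w : R3 → R3) from rfl,
          InnerProductSpace.laplacian_smul _ (w.smooth 2).contDiffAt, ← SchwartzMap.laplacian_apply,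
          hw, laplacian_rotField]
      have hf : ∀ x, fderiv ℝ (fun x => η t • w x) x = η t • fderiv ℝ w x := fun x =>
        fderiv_const_smul w.differentiableAt (η t)
      simp only [hd, hl, hf, inner_smul_right, _root_.smul_apply]
      rw [integral_add, integral_add, integral_const_mul, integral_const_mul, integral_const_mul]
      · ring
      · exact (hint _ _).const_mul _
      · exact (hint _ _).const_mul _
      · exact ((hint _ _).const_mul _).add ((hint _ _).const_mul _)
      · exact (integrable_conv_real _ _ _ _).const_mul _
    simp only [h3, inner_smul_right] at h2
    rwa [integral_const_mul] at h2

lemma laplacian_complexify (φ : 𝓢(R3, ℝ)) : Δ (complexify φ) = complexify (Δ φ) := by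
  rw [SchwartzMap.laplacian_eq_sum (EuclideanSpace.basisFun (Fin 3) ℝ),
    SchwartzMap.laplacian_eq_sum (EuclideanSpace.basisFun (Fin 3) ℝ)]
  simp only [lineDeriv_complexify]
  exact (map_sum (SchwartzMap.postcompCLM Complex.ofRealCLM) _ _).symm

lemma exists_bound_vort_laplacian (i j : Fin 3) :
    ∃ S : 𝓢(R3, ℂ) → ℝ, Continuous S ∧ ∀ f ψ, ‖vort f i j (Δ ψ)‖ ≤ 2 * ‖f‖ ^ 2 + S ψ := by
  let D : Fin 3 → 𝓢(R3, ℂ) →L[ℂ] Lp ℂ 2 (volume : Measure R3) := fun k =>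
    (SchwartzMap.toLpCLM ℂ ℂ 2).comp ((lineDerivOpCLM ℂ 𝓢(R3, ℂ) (e k)).comp
      (LineDeriv.laplacianCLM ℂ R3 𝓢(R3, ℂ)))
  refine ⟨fun ψ => ‖D i ψ‖ ^ 2 + ‖D j ψ‖ ^ 2, by fun_prop, fun f ψ => ?_⟩
  rw [vort_apply]
  refine (norm_sub_le _ _).trans ?_
  have h1 := norm_pair_le f j (∂_{e i} (Δ ψ))
  have h2 := norm_pair_le f i (∂_{e j} (Δ ψ))
  have h3 : ∀ k, D k ψ = (∂_{e k} (Δ ψ)).toLp 2 := fun k => by simp [D]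
  simp only [h3]
  linarith

/-- The equation for the curl of a weak solution, tested with a Schwartz function and integrated in
time. It extends from test functions by density, both sides being continuous in `ψ`. -/
lemma IsWeakSolution.vort_eq (hu : IsWeakSolution u₀ u) (i j : Fin 3) (ψ : 𝓢(R3, ℂ))
    {t : ℝ} (ht : 0 ≤ t) :
    vort (u t) i j ψ = vort (u 0) i j ψ +
      ∫ s in (0 : ℝ)..t, (vort (u s) i j (Δ ψ) + conv (u s) i j ψ) := by
  have hint : ∀ ψ : 𝓢(R3, ℂ), IntervalIntegrable (fun s => vort (u s) i j (Δ ψ) +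
      conv (u s) i j ψ) volume 0 t := fun ψ =>
    (hu.intervalIntegrable_vort i j _ le_rfl ht).add (hu.intervalIntegrable_conv i j _ le_rfl ht)
  have hΔadd : ∀ ψ χ : 𝓢(R3, ℂ), Δ (ψ + χ) = Δ ψ + Δ χ := fun ψ χ => by
    simp only [← SchwartzMap.laplacianCLM_eq ℂ, map_add]
  have hΔsmul : ∀ (c : ℂ) (ψ : 𝓢(R3, ℂ)), Δ (c • ψ) = c • Δ ψ := fun c ψ => by
    simp only [← SchwartzMap.laplacianCLM_eq ℂ, map_smul]
  let I : 𝓢(R3, ℂ) →ₗ[ℂ] ℂ :=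
    { toFun := fun ψ => ∫ s in (0 : ℝ)..t, (vort (u s) i j (Δ ψ) + conv (u s) i j ψ)
      map_add' := fun ψ χ => by
        rw [← intervalIntegral.integral_add (hint ψ) (hint χ)]
        simp only [hΔadd, map_add]
        refine intervalIntegral.integral_congr fun s _ => ?_
        ring
      map_smul' := fun c ψ => by
        simp only [hΔsmul, map_smul, smul_eq_mul, RingHom.id_apply]
        rw [← intervalIntegral.integral_const_mul]
        simp only [mul_add] }
  have hI : Continuous I := by
    obtain ⟨S₁, hS₁, hS₁'⟩ := exists_bound_conv i j
    obtain ⟨S₂, hS₂, hS₂'⟩ := exists_bound_vort_laplacian i j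
    obtain ⟨M, hM⟩ := hu.bounded t
    refine continuous_iff_continuousAt.2 fun ψ => ?_
    refine intervalIntegral.continuousAt_of_dominated_interval
      (bound := fun _ => 2 * M ^ 2 + (S₂ ψ + 1) + (|S₁ ψ| + 1) * M ^ 2) ?_ ?_
      intervalIntegrable_const ?_
    · exact Eventually.of_forall fun χ => (hint χ).def'.aestronglyMeasurable
    · filter_upwards [hS₁.abs.continuousAt.eventually (gt_mem_nhds (lt_add_one |S₁ ψ|)),
        hS₂.continuousAt.eventually (gt_mem_nhds (lt_add_one (S₂ ψ)))] with χ h1 h2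
      refine ae_of_all _ fun s hs => (norm_add_le _ _).trans ?_
      rw [uIoc_of_le ht] at hs
      have hMs := hM s ⟨hs.1.le, hs.2⟩
      have hMs2 : ‖u s‖ ^ 2 ≤ M ^ 2 := by gcongr
      have h3 := hS₁' (u s) χ
      have h4 := hS₂' (u s) χ
      have h5 : S₁ χ * ‖u s‖ ^ 2 ≤ (|S₁ ψ| + 1) * M ^ 2 := by
        gcongr
        exact (le_abs_self _).trans h1.le
      linarith
    · refine ae_of_all _ fun s _ => Continuous.continuousAt ?_
      simp only [← SchwartzMap.laplacianCLM_eq ℂ]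
      exact ((continuous_vort (u s) i j).comp
        (LineDeriv.laplacianCLM ℂ R3 𝓢(R3, ℂ)).continuous).add (continuous_conv (u s) i j)
  have hzero := ext_of_testFunctions (vort (u t) i j - vort (u 0) i j - I)
    (((continuous_vort _ i j).sub (continuous_vort _ i j)).sub hI) (fun φ hφ => by
      simp only [LinearMap.sub_apply]
      rw [hu.vort_complexify_eq i j hφ ht]
      simp only [I, LinearMap.coe_mk, AddHom.coe_mk, laplacian_complexify]
      ring) ψ
  simp only [LinearMap.sub_apply, sub_eq_zero] at hzero
  rw [sub_eq_iff_eq_add'] at hzero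
  exact hzero

end Evolution

/-! ### An abstract Duhamel estimate -/

/-- Diagonal estimate behind Duhamel's formula. Here `F r s` is the pairing of a solution at time
`r` with a test function depending on a parameter `s`; the evolution in `r` produces the terms
`L + N`, the evolution of the test function in `s` removes `L`, and only `N` survives along the
diagonal. -/
lemma norm_diag_le {F L N : ℝ → ℝ → ℂ} {T : ℝ} {m : ℝ → ℝ → ℝ} (hT : 0 ≤ T)
    (hF : ∀ s r, 0 ≤ s → s ≤ r → r ≤ T → F r r - F s r = ∫ q in s..r, (L q r + N q r))
    (hLN : ∀ s r, 0 ≤ s → s ≤ r → r ≤ T →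
      IntervalIntegrable (fun q => L q r + N q r) volume s r)
    (hFd : ∀ s ∈ Ico 0 T, HasDerivAt (fun s' => F s s') (-L s s) s)
    (hFc : ContinuousOn (fun s => F s s) (Icc 0 T))
    (hL : ContinuousOn (Function.uncurry L) (Icc 0 T ×ˢ Icc 0 T))
    (hN : ∀ r ∈ Icc 0 T, ∀ s ∈ Icc 0 T, ‖N r s‖ ≤ m r s)
    (hm : ContinuousOn (Function.uncurry m) (Icc 0 T ×ˢ Icc 0 T)) :
    ‖F T T‖ ≤ ‖F 0 0‖ + ∫ s in (0 : ℝ)..T, m s s := by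
  have hmd : ContinuousOn (fun s => m s s) (Icc 0 T) :=
    hm.comp (f := fun s => (s, s)) (by fun_prop) fun s hs => ⟨hs, hs⟩
  have hB : ContinuousOn (fun t => ‖F 0 0‖ + ∫ s in (0 : ℝ)..t, m s s) (Icc 0 T) := by
    have := intervalIntegral.continuousOn_primitive_interval' (μ := volume) (b₁ := 0) (b₂ := T)
      (hmd.intervalIntegrable_of_Icc hT) left_mem_uIcc
    rw [uIcc_of_le hT] at this
    exact continuousOn_const.add this
  have hB' : ∀ x ∈ Ico 0 T, HasDerivWithinAt (fun t => ‖F 0 0‖ + ∫ s in (0 : ℝ)..t, m s s)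
      (m x x) (Ici x) x := by
    intro x hx
    have hcw : ContinuousWithinAt (fun s => m s s) (Ici x) x :=
      (hmd x ⟨hx.1, hx.2.le⟩).mono_of_mem_nhdsWithin
        (mem_of_superset (Icc_mem_nhdsGE hx.2) (Icc_subset_Icc_left hx.1))
    refine HasDerivWithinAt.const_add _ (intervalIntegral.integral_hasDerivWithinAt_right
      (t := Ioi x)
      ((hmd.mono (Icc_subset_Icc_right hx.2.le)).intervalIntegrable_of_Icc hx.1) ?_
      (hcw.mono Ioi_subset_Ici_self))
    exact ⟨Ioc x T, Ioc_mem_nhdsGT hx.2, (hmd.mono fun y hy =>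
      ⟨hx.1.trans hy.1.le, hy.2⟩).aestronglyMeasurable measurableSet_Ioc⟩
  refine image_le_of_liminf_slope_right_le_deriv_boundary (f := fun s => ‖F s s‖)
    (continuous_norm.comp_continuousOn hFc) (by simp) hB hB' (fun x hx r hr => ?_)
    (right_mem_Icc.2 hT)
  refine Eventually.frequently ?_
  have hxm : x ∈ Icc 0 T := ⟨hx.1, hx.2.le⟩
  -- the increment is at most `(m x x + 3 ε) (y - x)`: one `ε` each for the oscillation of `L` and
  -- of `m`, and one for the derivative of `F` in its second argument
  set ε := (r - m x x) / 4 with hε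
  have hεpos : 0 < ε := by rw [hε]; linarith
  obtain ⟨δ₁, hδ₁, h1⟩ := Metric.continuousOn_iff.1 hL (x, x) ⟨hxm, hxm⟩ ε hεpos
  obtain ⟨δ₂, hδ₂, h2⟩ := Metric.continuousOn_iff.1 hm (x, x) ⟨hxm, hxm⟩ ε hεpos
  have h3 := (hasDerivAt_iff_isLittleO.1 (hFd x hx)).def hεpos
  filter_upwards [nhdsWithin_le_nhds h3, Ioc_mem_nhdsGT hx.2, self_mem_nhdsWithin,
    Ioo_mem_nhdsGT (show x < x + δ₁ by linarith), Ioo_mem_nhdsGT (show x < x + δ₂ by linarith)]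
    with y h3y hyT hxy hy1 hy2
  rw [mem_Ioi] at hxy
  have hpos : 0 < y - x := sub_pos.2 hxy
  have hyI : y ∈ Icc 0 T := ⟨hx.1.trans hxy.le, hyT.2⟩
  have hest : ‖F y y - F x x‖ ≤ (m x x + 3 * ε) * (y - x) := by
    have hsplit : F y y - F x x = (∫ q in x..y, (L q y + N q y - L x x)) +
        (F x y - F x x - (y - x) • (-L x x)) := by
      rw [intervalIntegral.integral_sub (hLN x y hx.1 hxy.le hyT.2) intervalIntegrable_const,
        ← hF x y hx.1 hxy.le hyT.2, intervalIntegral.integral_const]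
      simp only [smul_neg]
      ring
    have hI : ‖∫ q in x..y, (L q y + N q y - L x x)‖ ≤ (m x x + 2 * ε) * |y - x| := by
      refine intervalIntegral.norm_integral_le_of_norm_le_const fun q hq => ?_
      rw [uIoc_of_le hxy.le] at hq
      have hqI : q ∈ Icc 0 T := ⟨hx.1.trans hq.1.le, hq.2.trans hyT.2⟩
      have d1 : ∀ δ, y ∈ Ioo x (x + δ) → dist ((q, y) : ℝ × ℝ) (x, x) < δ := by
        intro δ hδ
        rw [Prod.dist_eq, max_lt_iff, Real.dist_eq, Real.dist_eq, abs_of_pos (by linarith [hq.1]),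
          abs_of_pos hpos]
        exact ⟨by linarith [hq.2, hδ.2], by linarith [hδ.2]⟩
      have e1 := h1 (q, y) ⟨hqI, hyI⟩ (d1 _ hy1)
      have e2 := h2 (q, y) ⟨hqI, hyI⟩ (d1 _ hy2)
      simp only [Function.uncurry, dist_eq_norm] at e1 e2
      have e3 := (le_abs_self _).trans (Real.norm_eq_abs _ ▸ e2.le)
      have e4 := hN q hqI y hyI
      calc ‖L q y + N q y - L x x‖ = ‖(L q y - L x x) + N q y‖ := by ring_nf
        _ ≤ ‖L q y - L x x‖ + ‖N q y‖ := norm_add_le _ _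
        _ ≤ _ := by linarith
    rw [hsplit]
    refine (norm_add_le _ _).trans ?_
    rw [Real.norm_of_nonneg hpos.le] at h3y
    rw [abs_of_pos hpos] at hI
    have h3y' : ‖F x y - F x x - (y - x) • (-L x x)‖ ≤ ε * (y - x) := h3y
    linarith
  rw [slope_def_field, div_lt_iff₀ hpos]
  have h5 := (abs_le.1 (abs_norm_sub_norm_le (F y y) (F x x))).2
  have h6 : (m x x + 3 * ε) * (y - x) < r * (y - x) := by
    apply mul_lt_mul_of_pos_right _ hpos
    rw [hε]; linarith
  linarith

/-! ### The curl in Fourier space and heat multipliers -/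

lemma lam_nonneg (ξ : R3) : 0 ≤ lam ξ := sq_nonneg _

lemma lam_eq_sum (ξ : R3) : lam ξ = (2 * Real.pi) ^ 2 * ∑ k, (ξ k) ^ 2 := by
  rw [lam, mul_pow, EuclideanSpace.norm_sq_eq]; simp

lemma contDiff_lam : ContDiff ℝ ∞ lam := by
  have : lam = fun ξ => (2 * Real.pi) ^ 2 * ‖ξ‖ ^ 2 := by ext; rw [lam, mul_pow]
  rw [this]
  exact contDiff_const.mul (contDiff_norm_sq ℝ)

lemma continuous_lam : Continuous lam := contDiff_lam.continuous

/-- The components `ξ_i f̂_j - ξ_j f̂_i`, which describe the Fourier transform of the curl of `f` up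
to the factor `2πi`. -/
def curlHat (i j : Fin 3) (f : L2) (ξ : R3) : ℂ := (ξ i : ℂ) * hat f ξ j - (ξ j : ℂ) * hat f ξ i

lemma locallyIntegrable_curlHat (i j : Fin 3) (f : L2) : LocallyIntegrable (curlHat i j f) :=
  (locallyIntegrable_coord_mul_hat f j i).sub (locallyIntegrable_coord_mul_hat f i j)

lemma norm_coord_le (v : C3) (k : Fin 3) : ‖v k‖ ≤ ‖v‖ := PiLp.norm_apply_le v k

lemma norm_curlHat_le (i j : Fin 3) (f : L2) (ξ : R3) :
    ‖curlHat i j f ξ‖ ≤ 2 * (‖ξ‖ * ‖hat f ξ‖) := by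
  refine (norm_sub_le _ _).trans ?_
  rw [norm_mul, norm_mul, Complex.norm_real, Complex.norm_real, Real.norm_eq_abs, Real.norm_eq_abs]
  have h1 := mul_le_mul (abs_coord_le_norm ξ i) (norm_coord_le (hat f ξ) j) (norm_nonneg _)
    (norm_nonneg _)
  have h2 := mul_le_mul (abs_coord_le_norm ξ j) (norm_coord_le (hat f ξ) i) (norm_nonneg _)
    (norm_nonneg _)
  linarith

lemma vort_fourier (f : L2) (i j : Fin 3) (χ : 𝓢(R3, ℂ)) :
    vort f i j (𝓕 χ) = -(2 * Real.pi * Complex.I) * ∫ ξ, χ ξ * curlHat i j f ξ := by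
  have hint : ∀ k l, Integrable fun ξ : R3 => χ ξ * ((ξ l : ℂ) * hat f ξ k) := fun k l =>
    (integrable_mul_hat f k (mulCoord l χ)).congr (ae_of_all _ fun ξ => by simp; ring)
  rw [vort_apply, pair_lineDeriv_fourier, pair_lineDeriv_fourier, ← mul_sub,
    ← integral_sub (hint j i) (hint i j)]
  simp only [curlHat, mul_sub]

lemma lineDeriv_lineDeriv_fourier (χ : 𝓢(R3, ℂ)) (k l : Fin 3) :
    ∂_{e k} (∂_{e l} (𝓕 χ)) =
      𝓕 ((-(2 * Real.pi) ^ 2 : ℂ) • mulCoord k (mulCoord l χ)) := by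
  rw [lineDeriv_fourier, lineDeriv_fourier]
  congr 1
  ext ξ
  simp only [_root_.smul_apply, map_smul, mulCoord_apply, smul_eq_mul]
  linear_combination (2 * Real.pi) ^ 2 * (ξ k : ℂ) * (ξ l * χ ξ) * Complex.I_sq

lemma vort_laplacian_fourier (f : L2) (i j : Fin 3) (χ : 𝓢(R3, ℂ)) :
    vort f i j (Δ (𝓕 χ)) = (2 * Real.pi * Complex.I) * ∫ ξ, lam ξ * (χ ξ * curlHat i j f ξ) := by
  have h : Δ (𝓕 χ) = 𝓕 (∑ k, (-(2 * Real.pi) ^ 2 : ℂ) • mulCoord k (mulCoord k χ)) := by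
    rw [SchwartzMap.laplacian_eq_sum (EuclideanSpace.basisFun (Fin 3) ℝ)]
    have h1 : ∀ k, EuclideanSpace.basisFun (Fin 3) ℝ k = e k := fun k => by simp [e]
    simp only [h1, lineDeriv_lineDeriv_fourier]
    exact (map_sum (FourierTransform.fourierCLM ℂ 𝓢(R3, ℂ)) _ _).symm
  rw [h, vort_fourier, neg_mul, ← mul_neg, ← integral_neg]
  congr 1
  refine integral_congr_ae (ae_of_all _ fun ξ => ?_)
  simp only [Fin.sum_univ_three, _root_.add_apply, _root_.smul_apply, mulCoord_apply, smul_eq_mul,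
    lam_eq_sum]
  push_cast
  ring

lemma norm_fourier_le (χ : 𝓢(R3, ℂ)) (x : R3) : ‖𝓕 χ x‖ ≤ ∫ ξ, ‖χ ξ‖ := by
  rw [SchwartzMap.fourier_coe]
  exact VectorFourier.norm_fourierIntegral_le_integral_norm _ _ _ _ _

lemma norm_lineDeriv_lineDeriv_fourier_le (χ : 𝓢(R3, ℂ)) (k l : Fin 3) (x : R3)
    (hχ : Integrable fun ξ => lam ξ * ‖χ ξ‖) :
    ‖∂_{e k} (∂_{e l} (𝓕 χ)) x‖ ≤ ∫ ξ, lam ξ * ‖χ ξ‖ := by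
  rw [lineDeriv_lineDeriv_fourier]
  refine (norm_fourier_le _ x).trans (integral_mono (SchwartzMap.integrable _).norm hχ fun ξ => ?_)
  simp only [_root_.smul_apply, mulCoord_apply, smul_eq_mul, norm_mul, norm_neg, norm_pow,
    Complex.norm_real, Real.norm_eq_abs, lam, mul_pow]
  have h := mul_le_mul (abs_coord_le_norm ξ k) (abs_coord_le_norm ξ l) (abs_nonneg _)
    (norm_nonneg _)
  simp only [Complex.norm_ofNat, abs_of_pos Real.pi_pos]
  calc _ = 2 ^ 2 * Real.pi ^ 2 * (|ξ k| * |ξ l|) * ‖χ ξ‖ := by ring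
    _ ≤ 2 ^ 2 * Real.pi ^ 2 * (‖ξ‖ * ‖ξ‖) * ‖χ ξ‖ := by gcongr
    _ = _ := by ring

lemma integrable_mul_curlHat {ρ : R3 → ℝ} (hρ : Continuous ρ) (hρc : HasCompactSupport ρ)
    (i j : Fin 3) (f : L2) : Integrable fun ξ => (ρ ξ : ℂ) * curlHat i j f ξ :=
  (locallyIntegrable_curlHat i j f).integrable_smul_left_of_hasCompactSupport hρ hρc |>.congr
    (ae_of_all _ fun _ => by simp)

lemma exists_integral_norm_mul_curlHat_le {ρ : R3 → ℝ} (hρ : Continuous ρ)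
    (hρc : HasCompactSupport ρ) (i j : Fin 3) :
    ∃ C, ∀ f : L2, ∫ ξ, ‖(ρ ξ : ℂ) * curlHat i j f ξ‖ ≤ C + ‖f‖ ^ 2 := by
  refine ⟨∫ ξ, (ρ ξ * ‖ξ‖) ^ 2, fun f => ?_⟩
  have h1 : Integrable fun ξ : R3 => (ρ ξ * ‖ξ‖) ^ 2 := by
    refine Continuous.integrable_of_hasCompactSupport (by fun_prop) ?_
    exact (hρc.mul_right (f' := fun ξ : R3 => ‖ξ‖)).comp_left (g := fun x : ℝ => x ^ 2) (by simp)
  have h2 : Integrable fun ξ => ‖hat f ξ‖ ^ 2 :=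
    (memLp_two_iff_integrable_sq_norm (Lp.aestronglyMeasurable _)).1 (Lp.memLp (hat f))
  have h3 : ‖f‖ ^ 2 = ∫ ξ, ‖hat f ξ‖ ^ 2 := by
    rw [← norm_hat, ← inner_self_eq_norm_sq (𝕜 := ℂ), L2.inner_def]
    have : ∫ ξ, ⟪hat f ξ, hat f ξ⟫_ℂ = ((∫ ξ, ‖hat f ξ‖ ^ 2 : ℝ) : ℂ) := by
      rw [← integral_complex_ofReal]
      refine integral_congr_ae (ae_of_all _ fun ξ => ?_)
      simp only [inner_self_eq_norm_sq_to_K]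
      simp
    rw [this]; simp
  rw [h3, ← integral_add h1 h2]
  refine integral_mono (integrable_mul_curlHat hρ hρc i j f).norm (h1.add h2) fun ξ => ?_
  simp only [norm_mul, Complex.norm_real, Real.norm_eq_abs]
  have h4 := mul_le_mul_of_nonneg_left (norm_curlHat_le i j f ξ) (abs_nonneg (ρ ξ))
  rw [mul_pow, ← sq_abs (ρ ξ), ← mul_pow]
  linarith [sq_nonneg (|ρ ξ| * ‖ξ‖ - ‖hat f ξ‖),
    show (|ρ ξ| * ‖ξ‖ - ‖hat f ξ‖) ^ 2 = (|ρ ξ| * ‖ξ‖) ^ 2 + ‖hat f ξ‖ ^ 2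
      - |ρ ξ| * (2 * (‖ξ‖ * ‖hat f ξ‖)) by ring]

/-- The Schwartz function `e^{-τ lam} θ`, for a test function `θ`. -/
def heatTest {θ : R3 → ℝ} (hθ : ContDiff ℝ ∞ θ) (hθc : HasCompactSupport θ) (τ : ℝ) :
    𝓢(R3, ℂ) :=
  complexify (HasCompactSupport.toSchwartzMap
    (f := fun ξ => Real.exp (-τ * lam ξ) * θ ξ) hθc.mul_left
    ((Real.contDiff_exp.comp (contDiff_const.mul contDiff_lam)).mul hθ))

@[simp] lemma heatTest_apply {θ : R3 → ℝ} (hθ : ContDiff ℝ ∞ θ) (hθc : HasCompactSupport θ)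
    (τ : ℝ) (ξ : R3) : heatTest hθ hθc τ ξ = ((Real.exp (-τ * lam ξ) * θ ξ : ℝ) : ℂ) := rfl

lemma abs_exp_sub_exp_le {a b : ℝ} (ha : a ≤ 0) (hb : b ≤ 0) :
    |Real.exp a - Real.exp b| ≤ |a - b| := by
  wlog h : b ≤ a generalizing a b
  · rw [abs_sub_comm, abs_sub_comm a b]
    exact this hb ha (le_of_not_ge h)
  rw [abs_of_nonneg (sub_nonneg.2 (Real.exp_le_exp.2 h)), abs_of_nonneg (sub_nonneg.2 h)]
  have h1 := Real.add_one_le_exp (b - a)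
  have h2 : Real.exp b = Real.exp a * Real.exp (b - a) := by rw [← Real.exp_add]; ring_nf
  have h3 := Real.exp_le_one_iff.2 ha
  have h4 : 0 ≤ a - b := by linarith
  nlinarith [Real.exp_pos a]

section Duhamel

variable {u₀ : L2} {u : ℝ → L2} {θ : R3 → ℝ} {T : ℝ}

/-- Joint continuity of pairings of the solution with `e^{-(T-s) lam} ρ`. -/
lemma continuousOn_heat_pairing (hM : ∃ M : ℝ, ∀ t ∈ Icc 0 T, ‖u t‖ ≤ M) {ρ : R3 → ℝ}
    (hρ : Continuous ρ) (hρc : HasCompactSupport ρ) (i j : Fin 3)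
    (h : ∀ s ∈ Icc 0 T, ContinuousOn (fun r => ∫ ξ, ((Real.exp (-(T - s) * lam ξ) * ρ ξ : ℝ) : ℂ) *
      curlHat i j (u r) ξ) (Icc 0 T)) :
    ContinuousOn (Function.uncurry fun r s => ∫ ξ, ((Real.exp (-(T - s) * lam ξ) * ρ ξ : ℝ) : ℂ) *
      curlHat i j (u r) ξ) (Icc 0 T ×ˢ Icc 0 T) := by
  obtain ⟨M, hM⟩ := hM
  have hρ' : Continuous fun ξ => lam ξ * ρ ξ := continuous_lam.mul hρ
  have hρc' : HasCompactSupport fun ξ => lam ξ * ρ ξ := hρc.mul_left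
  obtain ⟨C, hC⟩ := exists_integral_norm_mul_curlHat_le hρ' hρc' i j
  refine continuousOn_prod_of_continuousOn_lipschitzOnWith' _ (C + M ^ 2).toNNReal
    (fun r hr => ?_) h
  refine LipschitzOnWith.of_dist_le_mul fun s hs s' hs' => ?_
  have hint : ∀ s, Integrable fun ξ => ((Real.exp (-(T - s) * lam ξ) * ρ ξ : ℝ) : ℂ) *
      curlHat i j (u r) ξ := fun s =>
    integrable_mul_curlHat ((Real.continuous_exp.comp (continuous_const.mul continuous_lam)).mul hρ)
      hρc.mul_left i j (u r)
  simp only [Function.uncurry, dist_eq_norm]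
  rw [← integral_sub (hint s) (hint s')]
  calc _ ≤ ∫ ξ, ‖((lam ξ * ρ ξ : ℝ) : ℂ) * curlHat i j (u r) ξ‖ * ‖s - s'‖ := by
        refine norm_integral_le_of_norm_le
          ((integrable_mul_curlHat hρ' hρc' i j (u r)).norm.mul_const _) (ae_of_all _ fun ξ => ?_)
        rw [← sub_mul, norm_mul, norm_mul, ← Complex.ofReal_sub, Complex.norm_real,
          Complex.norm_real, ← sub_mul, norm_mul, norm_mul, Real.norm_of_nonneg (lam_nonneg ξ)]
        have h1 := abs_exp_sub_exp_le (a := -(T - s) * lam ξ) (b := -(T - s') * lam ξ)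
          (mul_nonpos_of_nonpos_of_nonneg (by linarith [hs.2]) (lam_nonneg ξ))
          (mul_nonpos_of_nonpos_of_nonneg (by linarith [hs'.2]) (lam_nonneg ξ))
        rw [show -(T - s) * lam ξ - -(T - s') * lam ξ = lam ξ * (s - s') by ring, abs_mul,
          abs_of_nonneg (lam_nonneg ξ)] at h1
        simp only [Real.norm_eq_abs] at h1 ⊢
        calc _ ≤ lam ξ * |s - s'| * |ρ ξ| * ‖curlHat i j (u r) ξ‖ := by gcongr
          _ = _ := by ring
    _ ≤ _ := by
        rw [integral_mul_const]
        gcongr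
        refine ((hC (u r)).trans ?_).trans (Real.le_coe_toNNReal _)
        have := hM r hr
        gcongr

lemma hasDerivAt_heat_pairing (hθ : Continuous θ) (hθc : HasCompactSupport θ) (i j : Fin 3) (f : L2)
    (s : ℝ) : HasDerivAt (fun s => ∫ ξ, ((Real.exp (-(T - s) * lam ξ) * θ ξ : ℝ) : ℂ) *
      curlHat i j f ξ) (∫ ξ, ((Real.exp (-(T - s) * lam ξ) * (lam ξ * θ ξ) : ℝ) : ℂ) *
      curlHat i j f ξ) s := by
  have hint : ∀ s (ρ : R3 → ℝ), Continuous ρ → HasCompactSupport ρ →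
      Integrable fun ξ => ((Real.exp (-(T - s) * lam ξ) * ρ ξ : ℝ) : ℂ) * curlHat i j f ξ :=
    fun s ρ hρ hρc =>
    integrable_mul_curlHat ((Real.continuous_exp.comp (continuous_const.mul continuous_lam)).mul hρ)
      hρc.mul_left i j f
  have hρ' : Continuous fun ξ => lam ξ * θ ξ := continuous_lam.mul hθ
  have hρc' : HasCompactSupport fun ξ => lam ξ * θ ξ := hθc.mul_left
  refine (hasDerivAt_integral_of_dominated_loc_of_deriv_le (Metric.ball_mem_nhds s one_pos)
    (F := fun s ξ => ((Real.exp (-(T - s) * lam ξ) * θ ξ : ℝ) : ℂ) * curlHat i j f ξ)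
    (F' := fun s ξ => ((Real.exp (-(T - s) * lam ξ) * (lam ξ * θ ξ) : ℝ) : ℂ) * curlHat i j f ξ)
    (bound := fun ξ => ‖((Real.exp (-(T - (s + 1)) * lam ξ) * (lam ξ * θ ξ) : ℝ) : ℂ) *
      curlHat i j f ξ‖)
    (Eventually.of_forall fun s => (hint s θ hθ hθc).aestronglyMeasurable) (hint s θ hθ hθc)
    (hint s _ hρ' hρc').aestronglyMeasurable (ae_of_all _ fun ξ x hx => ?_)
    (hint (s + 1) _ hρ' hρc').norm (ae_of_all _ fun ξ x hx => ?_)).2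
  · simp only [norm_mul, Complex.norm_real, Real.norm_eq_abs, Real.abs_exp]
    have : x ≤ s + 1 := by
      rw [Metric.mem_ball, Real.dist_eq] at hx
      linarith [(abs_lt.1 hx).2]
    have := lam_nonneg ξ
    gcongr
  · have h1 : HasDerivAt (fun x => -(T - x) * lam ξ) (lam ξ) x := by
      simpa using (((hasDerivAt_id x).const_sub T).neg.mul_const (lam ξ))
    have h2 := ((h1.exp.mul_const (θ ξ)).ofReal_comp).mul_const (curlHat i j f ξ)
    rwa [mul_assoc (Real.exp _)] at h2

end Duhamel

/-! ### Duhamel's formula as a pointwise bound in Fourier space -/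

/-- A pointwise bound follows from bounds on all averages against nonnegative test functions. -/
lemma ae_norm_le_of_forall_norm_integral_le {Z : R3 → ℂ} {K : R3 → ℝ} (hZ : LocallyIntegrable Z)
    (hK : LocallyIntegrable K)
    (h : ∀ θ : R3 → ℝ, ContDiff ℝ ∞ θ → HasCompactSupport θ → (∀ ξ, 0 ≤ θ ξ) →
      ‖∫ ξ, (θ ξ : ℂ) * Z ξ‖ ≤ ∫ ξ, θ ξ * K ξ) : ∀ᵐ ξ, ‖Z ξ‖ ≤ K ξ := by
  let φ : ℕ → ContDiffBump (0 : R3) := fun n =>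
    { rIn := 1 / ((n : ℝ) + 1)
      rOut := 2 * (1 / ((n : ℝ) + 1))
      rIn_pos := by positivity
      rIn_lt_rOut := by linarith [show (0 : ℝ) < 1 / ((n : ℝ) + 1) by positivity] }
  have hφ : Tendsto (fun n => (φ n).rOut) atTop (𝓝 0) := by
    have := (tendsto_one_div_add_atTop_nhds_zero_nat (𝕜 := ℝ)).const_mul 2
    rwa [mul_zero] at this
  have hφ' : ∀ᶠ n in atTop, (φ n).rOut ≤ 2 * (φ n).rIn := Eventually.of_forall fun n => le_rfl
  filter_upwards [ContDiffBump.ae_convolution_tendsto_right_of_locallyIntegrable hφ hφ' hZ,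
    ContDiffBump.ae_convolution_tendsto_right_of_locallyIntegrable hφ hφ' hK] with x h1 h2
  -- at Lebesgue points both sides are limits of averages against bumps centred there
  refine le_of_tendsto_of_tendsto' h1.norm h2 fun n => ?_
  rw [convolution_lsmul_swap, convolution_lsmul_swap]
  have h3 := h (fun ξ => (φ n).normed volume (x - ξ))
    ((φ n).contDiff_normed.comp (contDiff_const.sub contDiff_id))
    ((φ n).hasCompactSupport_normed.comp_homeomorph (Homeomorph.subLeft x))
    fun ξ => (φ n).nonneg_normed _
  simpa using h3

/-- The convolution in time of `b` with the heat multiplier. -/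
def heatPot (b : ℝ → ℝ) (T : ℝ) (ξ : R3) : ℝ :=
  ∫ r in (0 : ℝ)..T, b r * Real.exp (-(T - r) * lam ξ)

lemma continuous_heatPot {b : ℝ → ℝ} (hb : Continuous b) (T : ℝ) : Continuous (heatPot b T) := by
  have := continuous_lam
  exact intervalIntegral.continuous_parametric_intervalIntegral_of_continuous' (by fun_prop) 0 T

lemma integral_mul_heatPot {b : ℝ → ℝ} (hb : Continuous b) (T : ℝ) {ρ : R3 → ℝ}
    (hρ : Continuous ρ) (hρc : HasCompactSupport ρ) (hT : 0 ≤ T) :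
    ∫ r in (0 : ℝ)..T, b r * ∫ ξ, Real.exp (-(T - r) * lam ξ) * ρ ξ =
      ∫ ξ, ρ ξ * heatPot b T ξ := by
  have hl := continuous_lam
  have hint : Integrable (Function.uncurry fun (r : ℝ) (ξ : R3) =>
      b r * (Real.exp (-(T - r) * lam ξ) * ρ ξ)) ((volume.restrict (uIoc 0 T)).prod volume) := by
    have hbi : Integrable (fun r => ‖b r‖) (volume.restrict (uIoc 0 T)) := by
      rw [uIoc_of_le hT]
      exact (hb.norm.integrableOn_Icc (a := 0) (b := T)).mono_set Ioc_subset_Icc_self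
    have hρi : Integrable fun ξ => ‖ρ ξ‖ := (hρ.integrable_of_hasCompactSupport hρc).norm
    refine Integrable.mono (hbi.mul_prod hρi) ?_ ?_
    · exact Continuous.aestronglyMeasurable (by fun_prop)
    · have hR : ((volume.restrict (uIoc 0 T)).prod (volume : Measure R3)) =
          (volume.prod volume).restrict (uIoc 0 T ×ˢ univ) := by
        rw [← Measure.prod_restrict, Measure.restrict_univ]
      rw [hR]
      refine (ae_restrict_mem (measurableSet_uIoc.prod MeasurableSet.univ)).mono fun z hz => ?_
      rw [uIoc_of_le hT] at hz
      have h1 : Real.exp (-(T - z.1) * lam z.2) ≤ 1 := Real.exp_le_one_iff.2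
        (mul_nonpos_of_nonpos_of_nonneg (by linarith [hz.1.2]) (lam_nonneg _))
      simp only [Function.uncurry, norm_mul, norm_norm, Real.norm_of_nonneg (Real.exp_pos _).le]
      have := mul_le_mul_of_nonneg_right h1 (norm_nonneg (ρ z.2))
      rw [one_mul] at this
      gcongr
  simp only [heatPot, ← intervalIntegral.integral_const_mul, ← integral_const_mul]
  rw [intervalIntegral_integral_swap hint]
  refine integral_congr_ae (ae_of_all _ fun ξ => intervalIntegral.integral_congr fun r _ => ?_)
  ring

section Duhamel

variable {u₀ : L2} {u : ℝ → L2} {θ : R3 → ℝ} {T : ℝ} {b : ℝ → ℝ}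

/-- Duhamel's formula for the curl in Fourier space, in the form of an estimate for averages
against a nonnegative test function. -/
lemma IsWeakSolution.norm_integral_mul_curlHat_le (hu : IsWeakSolution u₀ u) (hb : Continuous b)
    (hub : ∀ r, 0 ≤ r → ‖u r‖ ^ 2 ≤ b r) (i j : Fin 3) (hT : 0 ≤ T) (hθ : ContDiff ℝ ∞ θ)
    (hθc : HasCompactSupport θ) (hθ0 : ∀ ξ, 0 ≤ θ ξ) :
    2 * Real.pi * ‖∫ ξ, (θ ξ : ℂ) * curlHat i j (u T) ξ‖ ≤
      2 * Real.pi * ‖∫ ξ, ((Real.exp (-T * lam ξ) * θ ξ : ℝ) : ℂ) * curlHat i j (u 0) ξ‖ +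
        6 * ∫ ξ, lam ξ * θ ξ * heatPot b T ξ := by
  have hl := continuous_lam
  have hθ' := hθ.continuous
  have hlθ : Continuous fun ξ => lam ξ * θ ξ := hl.mul hθ'
  have hlθc : HasCompactSupport fun ξ => lam ξ * θ ξ := hθc.mul_left
  have hIcc : Icc 0 T ⊆ Ici 0 := Icc_subset_Ici_self
  have hvF : ∀ r s, vort (u r) i j (𝓕 (heatTest hθ hθc (T - s))) = -(2 * Real.pi * Complex.I) *
      ∫ ξ, ((Real.exp (-(T - s) * lam ξ) * θ ξ : ℝ) : ℂ) * curlHat i j (u r) ξ := fun r s => by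
    rw [vort_fourier]; rfl
  have hvL : ∀ r s, vort (u r) i j (Δ (𝓕 (heatTest hθ hθc (T - s)))) =
      (2 * Real.pi * Complex.I) *
      ∫ ξ, ((Real.exp (-(T - s) * lam ξ) * (lam ξ * θ ξ) : ℝ) : ℂ) * curlHat i j (u r) ξ :=
    fun r s => by
    rw [vort_laplacian_fourier]
    congr 1
    refine integral_congr_ae (ae_of_all _ fun ξ => ?_)
    simp only [heatTest_apply]
    push_cast
    ring
  have hM : ∃ M : ℝ, ∀ t ∈ Icc 0 T, ‖u t‖ ≤ M := hu.bounded T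
  have h2πI : (2 * Real.pi * Complex.I : ℂ) ≠ 0 := Complex.two_pi_I_ne_zero
  have hcont : ∀ s ∈ Icc 0 T, ContinuousOn
      (fun r => ∫ ξ, ((Real.exp (-(T - s) * lam ξ) * θ ξ : ℝ) : ℂ) * curlHat i j (u r) ξ)
      (Icc 0 T) := fun s _ => by
    have := ((hu.continuousOn_vort i j (𝓕 (heatTest hθ hθc (T - s)))).mono hIcc).const_mul
      (-(2 * Real.pi * Complex.I : ℂ))⁻¹
    simp only [hvF] at this
    simpa only [inv_mul_cancel_left₀ (neg_ne_zero.2 h2πI)] using this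
  have hcontL : ∀ s ∈ Icc 0 T, ContinuousOn (fun r => ∫ ξ,
      ((Real.exp (-(T - s) * lam ξ) * (lam ξ * θ ξ) : ℝ) : ℂ) * curlHat i j (u r) ξ)
      (Icc 0 T) := fun s _ => by
    have := ((hu.continuousOn_vort i j (Δ (𝓕 (heatTest hθ hθc (T - s))))).mono hIcc).const_mul
      (2 * Real.pi * Complex.I : ℂ)⁻¹
    simp only [hvL] at this
    simpa only [inv_mul_cancel_left₀ h2πI] using this
  have hS : Continuous fun s => ∫ ξ, Real.exp (-(T - s) * lam ξ) * (lam ξ * θ ξ) := by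
    rw [← continuousOn_univ]
    refine continuousOn_integral_of_compact_support (k := tsupport θ) hθc
      (Continuous.continuousOn (by fun_prop)) fun s ξ _ hξ => ?_
    rw [image_eq_zero_of_notMem_tsupport hξ]; simp
  have hconv : ∀ r s, ‖conv (u r) i j (𝓕 (heatTest hθ hθc (T - s)))‖ ≤
      6 * (∫ ξ, Real.exp (-(T - s) * lam ξ) * (lam ξ * θ ξ)) * ‖u r‖ ^ 2 := fun r s => by
    have heq : ∀ ξ, lam ξ * ‖heatTest hθ hθc (T - s) ξ‖ =
        Real.exp (-(T - s) * lam ξ) * (lam ξ * θ ξ) := fun ξ => by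
      rw [heatTest_apply, Complex.norm_real, norm_mul, Real.norm_of_nonneg (hθ0 ξ),
        Real.norm_of_nonneg (Real.exp_pos _).le]
      ring
    have hi : Integrable fun ξ => lam ξ * ‖heatTest hθ hθc (T - s) ξ‖ := by
      simp only [heq]
      exact Continuous.integrable_of_hasCompactSupport (by fun_prop) hlθc.mul_left
    refine norm_conv_le _ i j _ fun k l x => ?_
    refine (norm_lineDeriv_lineDeriv_fourier_le _ k l x hi).trans_eq ?_
    simp only [heq]
  have key := norm_diag_le (T := T) (F := fun r s => vort (u r) i j (𝓕 (heatTest hθ hθc (T - s))))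
    (L := fun r s => vort (u r) i j (Δ (𝓕 (heatTest hθ hθc (T - s)))))
    (N := fun r s => conv (u r) i j (𝓕 (heatTest hθ hθc (T - s))))
    (m := fun r s => 6 * (∫ ξ, Real.exp (-(T - s) * lam ξ) * (lam ξ * θ ξ)) * b r) hT
    (fun s r hs hsr hrT => ?_) (fun s r hs hsr hrT => ?_) (fun s hs => ?_) ?_ ?_
    (fun r hr s hs => ?_) ?_
  · simp only [hvF, norm_mul, norm_neg, Complex.norm_I, mul_one, Complex.norm_real,
      Complex.norm_ofNat, Real.norm_of_nonneg Real.pi_pos.le] at key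
    have h0 : ∀ ξ, Real.exp (-(T - T) * lam ξ) = 1 := by simp
    simp only [h0, one_mul, sub_zero] at key
    refine key.trans_eq ?_
    congr 1
    rw [← integral_mul_heatPot hb T hlθ hlθc hT, ← intervalIntegral.integral_const_mul]
    refine intervalIntegral.integral_congr fun r _ => ?_
    ring
  · have h1 := hu.vort_eq i j (𝓕 (heatTest hθ hθc (T - r))) (hs.trans hsr)
    have h2 := hu.vort_eq i j (𝓕 (heatTest hθ hθc (T - r))) hs
    have hint : ∀ t, 0 ≤ t → IntervalIntegrable (fun q =>
        vort (u q) i j (Δ (𝓕 (heatTest hθ hθc (T - r)))) +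
          conv (u q) i j (𝓕 (heatTest hθ hθc (T - r)))) volume 0 t := fun t ht =>
      (hu.intervalIntegrable_vort i j _ le_rfl ht).add
        (hu.intervalIntegrable_conv i j _ le_rfl ht)
    rw [← intervalIntegral.integral_interval_sub_left (hint r (hs.trans hsr)) (hint s hs), h1, h2]
    ring
  · exact (hu.intervalIntegrable_vort i j _ hs (hs.trans hsr)).add
      (hu.intervalIntegrable_conv i j _ hs (hs.trans hsr))
  · simp only [hvF, hvL, ← neg_mul]
    exact (hasDerivAt_heat_pairing hθ' hθc i j (u s) s).const_mul _
  · simp only [hvF]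
    exact continuousOn_const.mul ((continuousOn_heat_pairing hM hθ' hθc i j hcont).comp
      (f := fun s => (s, s)) (by fun_prop) fun s hs => ⟨hs, hs⟩)
  · have := continuousOn_heat_pairing hM hlθ hlθc i j hcontL
    simp only [hvL]
    exact continuousOn_const.mul this
  · refine (hconv r s).trans ?_
    have : 0 ≤ ∫ ξ, Real.exp (-(T - s) * lam ξ) * (lam ξ * θ ξ) :=
      integral_nonneg fun ξ => mul_nonneg (Real.exp_pos _).le (mul_nonneg (lam_nonneg ξ) (hθ0 ξ))
    have := hub r hr.1
    gcongr
  · refine Continuous.continuousOn ?_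
    exact (continuous_const.mul (hS.comp continuous_snd)).mul (hb.comp continuous_fst)

/-- Duhamel's formula for the curl in Fourier space, as a pointwise estimate. -/
lemma IsWeakSolution.ae_norm_curlHat_le (hu : IsWeakSolution u₀ u) (hb : Continuous b)
    (hub : ∀ r, 0 ≤ r → ‖u r‖ ^ 2 ≤ b r) (i j : Fin 3) (hT : 0 ≤ T) :
    ∀ᵐ ξ, ‖curlHat i j (u T) ξ‖ ≤ Real.exp (-T * lam ξ) * ‖curlHat i j (u 0) ξ‖ +
      12 * Real.pi * ‖ξ‖ ^ 2 * heatPot b T ξ := by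
  have hl := continuous_lam
  have hW := continuous_heatPot hb T
  have hK1 : LocallyIntegrable fun ξ => Real.exp (-T * lam ξ) * ‖curlHat i j (u 0) ξ‖ :=
    LocallyIntegrable.continuous_mul (by fun_prop)
      fun ξ => (locallyIntegrable_curlHat i j (u 0) ξ).norm
  have hK2 : LocallyIntegrable fun ξ => 12 * Real.pi * ‖ξ‖ ^ 2 * heatPot b T ξ :=
    Continuous.locallyIntegrable (by fun_prop)
  refine ae_norm_le_of_forall_norm_integral_le (locallyIntegrable_curlHat i j _) (hK1.add hK2)
    fun θ hθ hθc hθ0 => ?_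
  have h1 := hu.norm_integral_mul_curlHat_le hb hub i j hT hθ hθc hθ0
  have hi1 : Integrable fun ξ => θ ξ * (Real.exp (-T * lam ξ) * ‖curlHat i j (u 0) ξ‖) :=
    hK1.integrable_smul_left_of_hasCompactSupport hθ.continuous hθc
  have hi2 : Integrable fun ξ => θ ξ * (12 * Real.pi * ‖ξ‖ ^ 2 * heatPot b T ξ) :=
    hK2.integrable_smul_left_of_hasCompactSupport hθ.continuous hθc
  simp only [mul_add]
  rw [integral_add hi1 hi2]
  have h2 : ‖∫ ξ, ((Real.exp (-T * lam ξ) * θ ξ : ℝ) : ℂ) * curlHat i j (u 0) ξ‖ ≤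
      ∫ ξ, θ ξ * (Real.exp (-T * lam ξ) * ‖curlHat i j (u 0) ξ‖) := by
    refine norm_integral_le_of_norm_le hi1 (ae_of_all _ fun ξ => le_of_eq ?_)
    rw [norm_mul, Complex.norm_real, norm_mul, Real.norm_of_nonneg (hθ0 ξ),
      Real.norm_of_nonneg (Real.exp_pos _).le]
    ring
  have h3 : 6 * ∫ ξ, lam ξ * θ ξ * heatPot b T ξ =
      2 * Real.pi * ∫ ξ, θ ξ * (12 * Real.pi * ‖ξ‖ ^ 2 * heatPot b T ξ) := by
    rw [← integral_const_mul, ← integral_const_mul]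
    refine integral_congr_ae (ae_of_all _ fun ξ => ?_)
    simp only [lam]; ring
  rw [h3] at h1
  have := mul_le_mul_of_nonneg_left h2 Real.two_pi_pos.le
  refine le_of_mul_le_mul_left ?_ Real.two_pi_pos
  linarith

/-- Lagrange's identity: a vector orthogonal to `ξ` is controlled by its cross product with `ξ`. -/
lemma norm_mul_le_of_sum_coord_mul_eq_zero {ξ : R3} {v : C3} {M : ℝ}
    (h0 : ∑ k, (ξ k : ℂ) * v k = 0)
    (hM : ∀ i j, ‖(ξ i : ℂ) * v j - (ξ j : ℂ) * v i‖ ≤ M) : ‖ξ‖ * ‖v‖ ≤ 3 * M := by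
  have hM0 : 0 ≤ M := (norm_nonneg _).trans (hM 0 0)
  have h1 : ∀ j, ‖ξ‖ ^ 2 * ‖v j‖ ≤ (∑ i, |ξ i|) * M := fun j => by
    -- expand `ξ × (ξ × v)`, where the term `ξ (ξ · v)` vanishes
    have h2 : ((‖ξ‖ ^ 2 : ℝ) : ℂ) * v j =
        ∑ i, (ξ i : ℂ) * ((ξ i : ℂ) * v j - (ξ j : ℂ) * v i) := by
      rw [EuclideanSpace.norm_sq_eq]
      simp only [Fin.sum_univ_three, Real.norm_eq_abs, sq_abs] at h0 ⊢
      push_cast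
      linear_combination (ξ j : ℂ) * h0
    have h3 : ‖ξ‖ ^ 2 * ‖v j‖ = ‖((‖ξ‖ ^ 2 : ℝ) : ℂ) * v j‖ := by
      rw [norm_mul, Complex.norm_real, Real.norm_of_nonneg (sq_nonneg _)]
    rw [h3, h2, Finset.sum_mul]
    refine (norm_sum_le _ _).trans (Finset.sum_le_sum fun i _ => ?_)
    rw [norm_mul, Complex.norm_real, Real.norm_eq_abs]
    exact mul_le_mul_of_nonneg_left (hM i j) (abs_nonneg _)
  have h2 : (∑ i, |ξ i|) ^ 2 ≤ 3 * ‖ξ‖ ^ 2 := by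
    have := sq_sum_le_card_mul_sum_sq (s := Finset.univ) (f := fun i => |ξ i|)
    simpa [EuclideanSpace.norm_sq_eq] using this
  have h3 : (‖ξ‖ ^ 2) ^ 2 * ‖v‖ ^ 2 ≤ 3 * ((3 * ‖ξ‖ ^ 2) * M ^ 2) := by
    rw [EuclideanSpace.norm_sq_eq v, Finset.mul_sum]
    have : ∀ j ∈ Finset.univ, (‖ξ‖ ^ 2) ^ 2 * ‖v j‖ ^ 2 ≤ (3 * ‖ξ‖ ^ 2) * M ^ 2 := fun j _ => by
      rw [← mul_pow]
      refine (pow_le_pow_left₀ (by positivity) (h1 j) 2).trans ?_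
      rw [mul_pow]
      gcongr
    simpa using Finset.sum_le_card_nsmul _ _ _ this
  rcases (norm_nonneg ξ).eq_or_lt with h | h
  · rw [← h]; linarith
  · refine abs_le_of_sq_le_sq' (le_of_mul_le_mul_left ?_ (pow_pos h 2)) (by positivity) |>.2
    linarith [show (‖ξ‖ ^ 2) ^ 2 * ‖v‖ ^ 2 = ‖ξ‖ ^ 2 * (‖ξ‖ * ‖v‖) ^ 2 by ring]

/-- Pointwise Fourier bound for weak solutions: the heat flow of the datum plus the contribution of
the nonlinearity, whose Fourier transform is controlled by the energy. -/
lemma IsWeakSolution.ae_norm_hat_le (hu : IsWeakSolution u₀ u) (hb : Continuous b)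
    (hub : ∀ r, 0 ≤ r → ‖u r‖ ^ 2 ≤ b r) (hT : 0 ≤ T) :
    ∀ᵐ ξ, ‖hat (u T) ξ‖ ≤ 6 * (Real.exp (-T * lam ξ) * ‖hat u₀ ξ‖) +
      36 * Real.pi * (‖ξ‖ * heatPot b T ξ) := by
  have h0 : ∀ᵐ ξ : R3, ξ ≠ 0 := by
    simp [ae_iff, measure_singleton]
  filter_upwards [(hu.divFree T hT).sum_coord_mul_hat, h0, ae_all_iff.2 fun i => ae_all_iff.2
    fun j => hu.ae_norm_curlHat_le hb hub i j hT] with ξ h1 h2 h3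
  have hpos : 0 < ‖ξ‖ := norm_pos_iff.2 h2
  have h4 := norm_mul_le_of_sum_coord_mul_eq_zero h1
    (M := Real.exp (-T * lam ξ) * (2 * (‖ξ‖ * ‖hat u₀ ξ‖)) +
      12 * Real.pi * ‖ξ‖ ^ 2 * heatPot b T ξ) fun i j => (h3 i j).trans (by
        have := norm_curlHat_le i j (u 0) ξ
        rw [hu.initial] at this ⊢
        gcongr)
  refine le_of_mul_le_mul_left (h4.trans_eq ?_) hpos
  ring

end Duhamel

/-! ### Low frequencies and pseudo-measure norms -/

lemma integrableOn_ball_norm_rpow {p : ℝ} (hp : -3 < p) (ρ : ℝ) :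
    IntegrableOn (fun ξ : R3 => ‖ξ‖ ^ p) (Metric.ball 0 ρ) := by
  rw [integrableOn_fun_norm_addHaar (μ := (volume : Measure R3)) (f := fun y => y ^ p)]
  have h : IntegrableOn (fun y : ℝ => y ^ (2 + p)) (Ioo 0 ρ) := by
    rcases le_or_gt ρ 0 with h | h
    · simp [Ioo_eq_empty_of_le h]
    · exact (intervalIntegral.integrableOn_Ioo_rpow_iff h).2 (by linarith)
  refine h.congr_fun (fun y hy => ?_) measurableSet_Ioo
  simp only [finrank_euclideanSpace, Fintype.card_fin, smul_eq_mul]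
  rw [Real.rpow_add hy.1]
  norm_num

lemma setIntegral_ball_norm_rpow {p : ℝ} (hp : -3 < p) {ρ : ℝ} (hρ : 0 < ρ) :
    ∫ ξ in Metric.ball (0 : R3) ρ, ‖ξ‖ ^ p =
      3 * volume.real (Metric.ball (0 : R3) 1) / (3 + p) * ρ ^ (3 + p) := by
  have h1 : ∫ ξ in Metric.ball (0 : R3) ρ, ‖ξ‖ ^ p =
      ∫ ξ : R3, (Iio ρ).indicator (fun y => y ^ p) ‖ξ‖ := by
    rw [← integral_indicator Metric.isOpen_ball.measurableSet]
    refine integral_congr_ae (ae_of_all _ fun ξ => ?_)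
    by_cases h : ‖ξ‖ < ρ <;> simp [indicator, h]
  rw [h1, integral_fun_norm_addHaar (μ := (volume : Measure R3))]
  have h2 : ∫ y in Ioi (0 : ℝ), y ^ (Module.finrank ℝ R3 - 1) • (Iio ρ).indicator (fun y => y ^ p) y
      = ρ ^ (3 + p) / (3 + p) := by
    have h3 : ∀ y ∈ Ioi (0 : ℝ), y ^ (Module.finrank ℝ R3 - 1) •
        (Iio ρ).indicator (fun y => y ^ p) y = (Iio ρ).indicator (fun y => y ^ (2 + p)) y := by
      intro y hy
      by_cases h : y < ρ
      · simp only [finrank_euclideanSpace, Fintype.card_fin, indicator, mem_Iio, h, if_true,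
          smul_eq_mul]
        rw [Real.rpow_add hy]
        norm_num
      · simp [indicator, h]
    rw [setIntegral_congr_fun measurableSet_Ioi h3, setIntegral_indicator measurableSet_Iio,
      Ioi_inter_Iio, ← integral_Ioc_eq_integral_Ioo, ← intervalIntegral.integral_of_le hρ.le,
      integral_rpow (Or.inl (by linarith)), Real.zero_rpow (by linarith)]
    ring_nf
  rw [h2]
  simp only [finrank_euclideanSpace, Fintype.card_fin, smul_eq_mul, nsmul_eq_mul]
  push_cast
  ring

/-- Low frequencies of a field whose Fourier transform obeys the bound produced by Duhamel's
formula. -/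
lemma exists_lintegral_ball_hat_le {σ : ℝ} (hσ : σ ≤ 1) :
    ∃ c : ℝ, 0 ≤ c ∧ ∀ (A I ρ : ℝ) (f : L2), 0 < ρ →
      (∀ᵐ ξ, ‖hat f ξ‖ ≤ A * ‖ξ‖ ^ (-σ) + I * ‖ξ‖) →
      ∫⁻ ξ in Metric.ball 0 ρ, ‖hat f ξ‖ₑ ^ 2 ≤
        ENNReal.ofReal (c * (A ^ 2 * ρ ^ (3 - 2 * σ) + I ^ 2 * ρ ^ (5 : ℝ))) := by
  set κ := 3 * volume.real (Metric.ball (0 : R3) 1)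
  have hκ : 0 ≤ κ := by positivity
  have hσ' : 0 < 3 - 2 * σ := by linarith
  refine ⟨2 * κ / (3 - 2 * σ) + 2 * κ, by positivity, fun A I ρ f hρ hf => ?_⟩
  have hi1 := (integrableOn_ball_norm_rpow (p := -2 * σ) (by linarith) ρ).const_mul (2 * A ^ 2)
  have hi2 := (integrableOn_ball_norm_rpow (p := 2) (by norm_num) ρ).const_mul (2 * I ^ 2)
  have h1 : ∫⁻ ξ in Metric.ball (0 : R3) ρ, ‖hat f ξ‖ₑ ^ 2 ≤ ∫⁻ ξ in Metric.ball (0 : R3) ρ,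
      ENNReal.ofReal (2 * A ^ 2 * ‖ξ‖ ^ (-2 * σ) + 2 * I ^ 2 * ‖ξ‖ ^ (2 : ℝ)) := by
    refine lintegral_mono_ae (ae_restrict_of_ae ?_)
    filter_upwards [hf] with ξ hξ
    rw [← ofReal_norm, ← ENNReal.ofReal_pow (norm_nonneg _)]
    refine ENNReal.ofReal_le_ofReal ((pow_le_pow_left₀ (norm_nonneg _) hξ 2).trans ?_)
    have h2 : ‖ξ‖ ^ (-2 * σ) = (‖ξ‖ ^ (-σ)) ^ 2 := by
      rw [← Real.rpow_mul_natCast (norm_nonneg _)]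
      congr 1; push_cast; ring
    rw [h2, Real.rpow_two]
    linarith [sq_nonneg (A * ‖ξ‖ ^ (-σ) - I * ‖ξ‖),
      show (A * ‖ξ‖ ^ (-σ) + I * ‖ξ‖) ^ 2 + (A * ‖ξ‖ ^ (-σ) - I * ‖ξ‖) ^ 2 =
        2 * A ^ 2 * (‖ξ‖ ^ (-σ)) ^ 2 + 2 * I ^ 2 * ‖ξ‖ ^ 2 by ring]
  refine h1.trans ?_
  rw [← ofReal_integral_eq_lintegral_ofReal
    (f := fun ξ : R3 => 2 * A ^ 2 * ‖ξ‖ ^ (-2 * σ) + 2 * I ^ 2 * ‖ξ‖ ^ (2 : ℝ)) (hi1.add hi2)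
    (ae_of_all _ fun ξ => by simp only [Pi.zero_apply]; positivity)]
  refine ENNReal.ofReal_le_ofReal ?_
  rw [integral_add hi1 hi2, integral_const_mul, integral_const_mul,
    setIntegral_ball_norm_rpow (by linarith) hρ, setIntegral_ball_norm_rpow (by norm_num) hρ]
  have e1 : (3 : ℝ) + -2 * σ = 3 - 2 * σ := by ring
  have e2 : (3 : ℝ) + 2 = 5 := by norm_num
  rw [e1, e2]
  have h3 : 0 ≤ A ^ 2 * ρ ^ (3 - 2 * σ) := by positivity
  have h4 : 0 ≤ I ^ 2 * ρ ^ (5 : ℝ) := by positivity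
  have h5 : 0 ≤ 2 * κ * (A ^ 2 * ρ ^ (3 - 2 * σ)) := by positivity
  have h6 : 0 ≤ 2 * κ / (3 - 2 * σ) * (I ^ 2 * ρ ^ (5 : ℝ)) := by positivity
  have h7 : 0 ≤ 2 * κ * (1 - 1 / 5) * (I ^ 2 * ρ ^ (5 : ℝ)) := by norm_num; positivity
  calc _ = 2 * κ / (3 - 2 * σ) * (A ^ 2 * ρ ^ (3 - 2 * σ)) +
        2 * κ / 5 * (I ^ 2 * ρ ^ (5 : ℝ)) := by ring
    _ ≤ _ := by
      rw [add_mul, mul_add, mul_add]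
      linarith

/-- Fourier splitting: outside the ball of radius `ρ` the energy is controlled by the
dissipation. -/
lemma ofReal_mul_sub_le_gradNormSq (f : L2) {ρ B : ℝ} (hρ : 0 < ρ) (hB : 0 ≤ B)
    (h : ∫⁻ ξ in Metric.ball 0 ρ, ‖hat f ξ‖ₑ ^ 2 ≤ ENNReal.ofReal B) :
    ENNReal.ofReal ((2 * Real.pi * ρ) ^ 2 * (‖f‖ ^ 2 - B)) ≤ gradNormSq f := by
  set c := (2 * Real.pi * ρ) ^ 2 with hc
  have hc0 : 0 ≤ c := sq_nonneg _
  have h1 : ENNReal.ofReal c * ∫⁻ ξ in (Metric.ball 0 ρ)ᶜ, ‖hat f ξ‖ₑ ^ 2 ≤ gradNormSq f := by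
    refine le_trans ?_ (lintegral_lam_mul_hat_le_gradNormSq f)
    rw [← lintegral_const_mul' _ _ ENNReal.ofReal_ne_top]
    refine (setLIntegral_mono_ae' Metric.isOpen_ball.measurableSet.compl
      (ae_of_all _ fun ξ hξ => ?_)).trans (setLIntegral_le_lintegral _ _)
    have : ρ ≤ ‖ξ‖ := by simpa using hξ
    gcongr
    rw [hc, lam]
    gcongr
  have h2 : ENNReal.ofReal c * ENNReal.ofReal (‖f‖ ^ 2) ≤
      ENNReal.ofReal c * ENNReal.ofReal B + gradNormSq f := by
    rw [ENNReal.ofReal_pow (norm_nonneg _), ofReal_norm, ← enorm_hat, enorm_sq_eq_lintegral,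
      ← lintegral_add_compl _ (Metric.isOpen_ball (x := (0 : R3)) (ε := ρ)).measurableSet, mul_add]
    gcongr
  rw [mul_sub, ENNReal.ofReal_sub _ (by positivity), tsub_le_iff_left, ENNReal.ofReal_mul hc0,
    ENNReal.ofReal_mul hc0]
  exact h2

/-- The pointwise meaning of a finite pseudo-measure norm. -/
lemma ae_norm_hat_le_of_pmNorm {σ : ℝ} {f : L2} (hf : pmNorm σ f < ⊤) :
    ∀ᵐ ξ, ‖hat f ξ‖ ≤ (pmNorm σ f).toReal * ‖ξ‖ ^ (-σ) := by
  have h0 : ∀ᵐ ξ : R3, ξ ≠ 0 := by simp [ae_iff, measure_singleton]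
  filter_upwards [h0, ENNReal.ae_le_essSup fun ξ : R3 => ‖ξ‖ₑ ^ σ * ‖hat f ξ‖ₑ] with ξ hξ h
  have hpos : 0 < ‖ξ‖ := norm_pos_iff.2 hξ
  have h1 := ENNReal.toReal_mono hf.ne h
  rw [ENNReal.toReal_mul, ← ENNReal.toReal_rpow, toReal_enorm, toReal_enorm] at h1
  rw [Real.rpow_neg hpos.le, ← div_eq_mul_inv, le_div_iff₀ (by positivity), mul_comm]
  exact h1

lemma pmNorm_le_of_ae {σ : ℝ} {f : L2} {C : ℝ} (h : ∀ᵐ ξ : R3, ‖ξ‖ ^ σ * ‖hat f ξ‖ ≤ C) :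
    pmNorm σ f ≤ ENNReal.ofReal C := by
  have h0 : ∀ᵐ ξ : R3, ξ ≠ 0 := by simp [ae_iff, measure_singleton]
  refine essSup_le_of_ae_le _ ?_
  filter_upwards [h0, h] with ξ hξ h
  have hpos : 0 < ‖ξ‖ := norm_pos_iff.2 hξ
  rw [← ofReal_norm, ENNReal.ofReal_rpow_of_pos hpos, ← ofReal_norm, ← ENNReal.ofReal_mul
    (by positivity)]
  exact ENNReal.ofReal_le_ofReal h

/-! ### Fourier splitting -/

lemma heatPot_le_integral {b : ℝ → ℝ} (hb : Continuous b) (hb0 : ∀ r, 0 ≤ r → 0 ≤ b r) {τ t : ℝ}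
    (hτ : 0 ≤ τ) (hτt : τ ≤ t) (ξ : R3) : heatPot b τ ξ ≤ ∫ r in (0 : ℝ)..t, b r := by
  have h1 : heatPot b τ ξ ≤ ∫ r in (0 : ℝ)..τ, b r := by
    refine intervalIntegral.integral_mono_on hτ (Continuous.intervalIntegrable (by fun_prop) _ _)
      (hb.intervalIntegrable _ _) fun r hr => mul_le_of_le_one_right (hb0 r hr.1) ?_
    exact Real.exp_le_one_iff.2
      (mul_nonpos_of_nonpos_of_nonneg (by linarith [hr.2]) (lam_nonneg ξ))
  refine h1.trans ?_
  rw [← intervalIntegral.integral_add_adjacent_intervals (hb.intervalIntegrable 0 τ)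
    (hb.intervalIntegrable τ t)]
  exact le_add_of_nonneg_right (intervalIntegral.integral_nonneg hτt fun r hr =>
    hb0 r (hτ.trans hr.1))

lemma EnergyInequalityFrom.norm_le {u : ℝ → L2} {s t : ℝ} (h : EnergyInequalityFrom u s)
    (hst : s ≤ t) : ‖u t‖ ≤ ‖u s‖ := by
  have h1 : ‖u t‖ₑ ^ 2 ≤ ‖u s‖ₑ ^ 2 := le_self_add.trans (h t hst)
  have h2 := (ENNReal.pow_le_pow_left_iff two_ne_zero).1 h1
  exact enorm_le_iff_norm_le.1 h2

/-- The energy inequality combined with a lower bound for the dissipation at almost all times. -/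
lemma EnergyInequalityFrom.norm_sq_add_le {u : ℝ → L2} {s t k : ℝ} (h : EnergyInequalityFrom u s)
    (hst : s ≤ t) (hk : 0 ≤ k)
    (hd : ∀ᵐ τ ∂volume.restrict (Ioc s t), ENNReal.ofReal k ≤ gradNormSq (u τ)) :
    ‖u t‖ ^ 2 + 2 * (k * (t - s)) ≤ ‖u s‖ ^ 2 := by
  have h1 : ENNReal.ofReal (k * (t - s)) ≤ ∫⁻ τ in Ioc s t, gradNormSq (u τ) := by
    refine le_trans (le_of_eq ?_) (lintegral_mono_ae hd)
    rw [lintegral_const, Measure.restrict_apply_univ, Real.volume_Ioc, ENNReal.ofReal_mul hk]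
  have h2 : ENNReal.ofReal (‖u t‖ ^ 2 + 2 * (k * (t - s))) ≤ ENNReal.ofReal (‖u s‖ ^ 2) := by
    have hts : 0 ≤ t - s := sub_nonneg.2 hst
    rw [ENNReal.ofReal_add (by positivity) (by positivity), ENNReal.ofReal_mul zero_le_two,
      ENNReal.ofReal_pow (norm_nonneg _), ENNReal.ofReal_pow (norm_nonneg _), ofReal_norm,
      ofReal_norm, ENNReal.ofReal_ofNat]
    refine le_trans ?_ (h t hst)
    gcongr
  exact (ENNReal.ofReal_le_ofReal_iff (sq_nonneg _)).1 h2

/-- One step of the Fourier splitting method: the energy at time `t` is a small multiple of the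
energy at an earlier time comparable to `t`, up to a contribution of the frequencies below
`t ^ (-1 / 2)`. The factor `1 / 27` comes from `8 π² / 3 ≥ 26`. -/
lemma exists_fourierSplitting {σ : ℝ} (hσ : σ ≤ 1) :
    ∃ c : ℝ, 0 ≤ c ∧ ∀ (u₀ : L2) (u : ℝ → L2) (b : ℝ → ℝ), pmNorm σ u₀ < ⊤ → IsLerayHopf u₀ u →
      Continuous b → (∀ r, 0 ≤ r → ‖u r‖ ^ 2 ≤ b r) → ∀ t, 1 ≤ t →
      ∃ s ∈ Icc (t / 2) (2 * t / 3), ‖u t‖ ^ 2 ≤ ‖u s‖ ^ 2 / 27 +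
        c * ((pmNorm σ u₀).toReal ^ 2 * t ^ (-(3 / 2) + σ) +
          (∫ r in (0 : ℝ)..t, b r) ^ 2 * t ^ (-(5 / 2) : ℝ)) := by
  obtain ⟨c, hc0, hc⟩ := exists_lintegral_ball_hat_le hσ
  refine ⟨c * (36 * Real.pi) ^ 2, by positivity, fun u₀ u b hA hu hb hub t ht => ?_⟩
  have ht0 : 0 < t := by linarith
  set A := (pmNorm σ u₀).toReal
  have hA0 : 0 ≤ A := ENNReal.toReal_nonneg
  set I := ∫ r in (0 : ℝ)..t, b r
  set ρ : ℝ := t ^ (-(1 / 2) : ℝ) with hρ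
  have hρ0 : 0 < ρ := by positivity
  have hρ1 : ρ ^ (3 - 2 * σ) = t ^ (-(3 / 2) + σ) := by
    rw [hρ, ← Real.rpow_mul ht0.le]; congr 1; ring
  have hρ2 : ρ ^ (5 : ℝ) = t ^ (-(5 / 2) : ℝ) := by
    rw [hρ, ← Real.rpow_mul ht0.le]; congr 1; ring
  have hρ3 : ρ ^ 2 = t⁻¹ := by
    rw [hρ, ← Real.rpow_mul_natCast ht0.le, ← Real.rpow_neg_one]; congr 1; norm_num
  set B := c * (36 * Real.pi) ^ 2 *
    (A ^ 2 * t ^ (-(3 / 2) + σ) + I ^ 2 * t ^ (-(5 / 2) : ℝ)) with hB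
  have hB0 : 0 ≤ B := by positivity
  have hpi : 3 < Real.pi := Real.pi_gt_three
  have hlow : ∀ τ, 0 ≤ τ → τ ≤ t →
      ∫⁻ ξ in Metric.ball 0 ρ, ‖hat (u τ) ξ‖ₑ ^ 2 ≤ ENNReal.ofReal B := by
    intro τ hτ hτt
    refine (hc (6 * A) (36 * Real.pi * I) ρ (u τ) hρ0 ?_).trans (ENNReal.ofReal_le_ofReal ?_)
    · filter_upwards [hu.weak.ae_norm_hat_le hb hub hτ, ae_norm_hat_le_of_pmNorm hA] with ξ h1 h2
      have h3 := heatPot_le_integral hb (fun r hr => (sq_nonneg _).trans (hub r hr)) hτ hτt ξ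
      have h4 : Real.exp (-τ * lam ξ) ≤ 1 := Real.exp_le_one_iff.2
        (mul_nonpos_of_nonpos_of_nonneg (by linarith) (lam_nonneg ξ))
      calc _ ≤ 6 * (1 * (A * ‖ξ‖ ^ (-σ))) + 36 * Real.pi * (‖ξ‖ * I) := by
            refine h1.trans ?_
            gcongr
        _ = _ := by ring
    · rw [hρ1, hρ2, hB, mul_assoc c]
      refine mul_le_mul_of_nonneg_left ?_ hc0
      rw [mul_add]
      refine add_le_add ?_ (le_of_eq (by ring))
      rw [mul_pow, ← mul_assoc]
      gcongr
      linarith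
  have hgood : ∃ s ∈ Ioo (t / 2) (2 * t / 3), EnergyInequalityFrom u s := by
    have h1 : ∀ᵐ s ∂volume.restrict (Ioo (t / 2) (2 * t / 3)), EnergyInequalityFrom u s :=
      ae_restrict_of_ae_restrict_of_subset (fun s hs => (by linarith : 0 < t / 2).trans hs.1)
        hu.strongEnergy
    have : (ae (volume.restrict (Ioo (t / 2) (2 * t / 3)))).NeBot := by
      rw [ae_neBot, Ne, Measure.restrict_eq_zero, Real.volume_Ioo, ENNReal.ofReal_eq_zero]
      linarith
    exact ((ae_restrict_mem measurableSet_Ioo).and h1).exists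
  obtain ⟨s, hs, hsE⟩ := hgood
  refine ⟨s, ⟨hs.1.le, hs.2.le⟩, ?_⟩
  rcases le_or_gt (‖u t‖ ^ 2) B with hle | hgt
  · linarith [sq_nonneg ‖u s‖]
  have hst : s ≤ t := by linarith [hs.2]
  have hk : 0 ≤ (2 * Real.pi * ρ) ^ 2 * (‖u t‖ ^ 2 - B) :=
    mul_nonneg (sq_nonneg _) (by linarith)
  -- the energy at almost every time in `(s, t)` is at least that at time `t`, so the dissipation
  -- there is at least `(2 π ρ)² (‖u t‖² - B)`
  have key := hsE.norm_sq_add_le hst hk ?_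
  · have h1 : 13 ≤ (2 * Real.pi * ρ) ^ 2 * (t - s) := by
      rw [mul_pow, hρ3]
      have h2 : t / 3 ≤ t - s := by linarith [hs.2]
      calc (13 : ℝ) ≤ (2 * 3.141592) ^ 2 / 3 := by norm_num
        _ ≤ (2 * Real.pi) ^ 2 / 3 := by
          have := Real.pi_gt_d6
          gcongr
        _ = (2 * Real.pi) ^ 2 * t⁻¹ * (t / 3) := by field_simp
        _ ≤ _ := by gcongr
    have h2 := mul_le_mul_of_nonneg_right h1 (sub_nonneg.2 hgt.le)
    have h3 : (2 * Real.pi * ρ) ^ 2 * (‖u t‖ ^ 2 - B) * (t - s) =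
      (2 * Real.pi * ρ) ^ 2 * (t - s) * (‖u t‖ ^ 2 - B) := by ring
    rw [h3] at key
    linarith
  · have hs0 : 0 < s := by linarith [hs.1]
    have h1 : ∀ᵐ τ ∂volume.restrict (Ioc s t), EnergyInequalityFrom u τ :=
      ae_restrict_of_ae_restrict_of_subset (fun τ hτ => hs0.trans hτ.1) hu.strongEnergy
    filter_upwards [h1, ae_restrict_mem measurableSet_Ioc] with τ h2 hτ
    refine le_trans (ENNReal.ofReal_le_ofReal ?_)
      (ofReal_mul_sub_le_gradNormSq (u τ) hρ0 hB0 (hlow τ (hs0.trans hτ.1).le hτ.2))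
    have := h2.norm_le hτ.2
    gcongr

/-- Comparable times have comparable decay factors; `6` bounds `2 ^ (5 / 2)`. -/
lemma rpow_neg_le_six_mul {α x y : ℝ} (hα : 0 ≤ α) (hα' : α ≤ 5 / 2) (hy : 0 < y)
    (hyx : y ≤ 2 * x) : x ^ (-α) ≤ 6 * y ^ (-α) := by
  have hx : 0 ≤ x := by linarith
  have h2 : (2 : ℝ) ^ α ≤ 6 := by
    have h3 : ((2 : ℝ) ^ (5 / 2 : ℝ)) ^ 2 = 32 := by
      rw [← Real.rpow_mul_natCast zero_le_two]; norm_num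
    have h4 : (2 : ℝ) ^ (5 / 2 : ℝ) ≤ 6 := by
      refine le_of_sq_le_sq ?_ (by norm_num)
      rw [h3]; norm_num
    exact (Real.rpow_le_rpow_of_exponent_le one_le_two hα').trans h4
  calc x ^ (-α) = 2 ^ α * (2 * x) ^ (-α) := by
        rw [Real.mul_rpow zero_le_two hx, ← mul_assoc, ← Real.rpow_add two_pos]
        simp
    _ ≤ 6 * y ^ (-α) := by
      have : (2 * x) ^ (-α) ≤ y ^ (-α) := Real.rpow_le_rpow_of_nonpos hy hyx (by linarith)
      gcongr

/-- Decay by iterating a contraction between times `t` and `s ∈ [t / 2, 2 t / 3]`. -/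
lemma le_rpow_of_contraction {y : ℝ → ℝ} {E D α : ℝ} (hα : 0 ≤ α) (hα' : α ≤ 5 / 2) (hE : 0 ≤ E)
    (hD : 0 ≤ D) (hyE : ∀ t, 0 ≤ t → y t ≤ E)
    (h : ∀ t, 1 ≤ t → ∃ s ∈ Icc (t / 2) (2 * t / 3), y t ≤ y s / 27 + D * (1 + t) ^ (-α)) :
    ∀ t, 0 ≤ t → y t ≤ (6 * E + 2 * D) * (1 + t) ^ (-α) := by
  -- the bound at times below `(3 / 2) ^ n` gives it below `(3 / 2) ^ (n + 1)`, as `s ≤ 2 t / 3`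
  have main : ∀ n : ℕ, ∀ t, 0 ≤ t → t < (3 / 2) ^ n →
      y t ≤ (6 * E + 2 * D) * (1 + t) ^ (-α) := by
    intro n
    induction n with
    | zero =>
      intro t ht0 ht
      rw [pow_zero] at ht
      have h1 : 1 ≤ 6 * (1 + t) ^ (-α) := by
        simpa using rpow_neg_le_six_mul (x := 1) (y := 1 + t) hα hα' (by linarith) (by linarith)
      have h4 : 0 ≤ D * (1 + t) ^ (-α) := by positivity
      nlinarith [hyE t ht0]
    | succ n ih =>
      intro t ht0 ht
      rcases lt_or_ge t 1 with h1 | h1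
      · exact ih t ht0 (h1.trans_le (one_le_pow₀ (by norm_num)))
      obtain ⟨s, hs, hy⟩ := h t h1
      have hs0 : 0 ≤ s := by linarith [hs.1]
      have h2 := ih s hs0 (by rw [pow_succ] at ht; linarith [hs.2])
      have h3 : (1 + s) ^ (-α) ≤ 6 * (1 + t) ^ (-α) :=
        rpow_neg_le_six_mul hα hα' (by linarith) (by linarith [hs.1])
      have hX : 0 ≤ (1 + t) ^ (-α) := by positivity
      have h4 := mul_le_mul_of_nonneg_left h3 (by positivity : 0 ≤ 6 * E + 2 * D)
      have h5 : 0 ≤ E * (1 + t) ^ (-α) := by positivity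
      have h6 : 0 ≤ D * (1 + t) ^ (-α) := by positivity
      linarith [show (6 * E + 2 * D) * (6 * (1 + t) ^ (-α)) =
        36 * (E * (1 + t) ^ (-α)) + 12 * (D * (1 + t) ^ (-α)) by ring]
  intro t ht
  obtain ⟨n, hn⟩ := pow_unbounded_of_one_lt t (by norm_num : (1 : ℝ) < 3 / 2)
  exact main n t ht hn

/-! ### Decay of the energy and propagation of the pseudo-measure norm -/

lemma continuous_one_add_abs_rpow (β : ℝ) : Continuous fun r : ℝ => (1 + |r|) ^ β :=
  (continuous_const.add continuous_abs).rpow_const fun r => Or.inl (by positivity : 0 < 1 + |r|).ne'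

lemma integral_one_add_abs_rpow {β : ℝ} (hβ : β ≠ -1) {t : ℝ} (ht : 0 ≤ t) :
    ∫ r in (0 : ℝ)..t, (1 + |r|) ^ β = ((1 + t) ^ (β + 1) - 1) / (β + 1) := by
  have h1 : ∫ r in (0 : ℝ)..t, (1 + |r|) ^ β = ∫ r in (0 : ℝ)..t, (1 + r) ^ β := by
    refine intervalIntegral.integral_congr fun r hr => ?_
    rw [uIcc_of_le ht] at hr
    simp only [abs_of_nonneg hr.1]
  rw [h1, intervalIntegral.integral_comp_add_left (fun x => x ^ β) 1,
    integral_rpow (Or.inr ⟨hβ, ?_⟩)]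
  · simp
  · rw [uIcc_of_le (by linarith)]
    intro h
    linarith [h.1]

/-- One round of the decay argument: a bound on the time integral of the energy improves the decay
of the energy. -/
lemma exists_decay_round {σ : ℝ} (hσ : σ ∈ Icc (-1 : ℝ) 1) :
    ∃ c : ℝ, 0 ≤ c ∧ ∀ (u₀ : L2) (u : ℝ → L2) (b : ℝ → ℝ) (K γ α : ℝ), pmNorm σ u₀ < ⊤ →
      IsLerayHopf u₀ u → Continuous b → (∀ r, 0 ≤ r → ‖u r‖ ^ 2 ≤ b r) →
      (∀ t, 1 ≤ t → ∫ r in (0 : ℝ)..t, b r ≤ K * t ^ γ) → 0 ≤ α → α ≤ 3 / 2 - σ →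
      α ≤ 5 / 2 - 2 * γ → ∀ t, 0 ≤ t → ‖u t‖ ^ 2 ≤
        (6 * ‖u₀‖ ^ 2 + c * ((pmNorm σ u₀).toReal ^ 2 + K ^ 2)) * (1 + t) ^ (-α) := by
  obtain ⟨c, hc0, hc⟩ := exists_fourierSplitting hσ.2
  refine ⟨12 * c, by positivity, fun u₀ u b K γ α hA hu hb hub hI hα hα1 hα2 => ?_⟩
  set A := (pmNorm σ u₀).toReal
  have hα' : α ≤ 5 / 2 := by linarith [hσ.1]
  have key := le_rpow_of_contraction (y := fun t => ‖u t‖ ^ 2) (E := ‖u₀‖ ^ 2)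
    (D := 6 * (c * (A ^ 2 + K ^ 2))) hα hα' (by positivity) (by positivity) (fun t ht => ?_)
    fun t ht => ?_
  · refine fun t ht => (key t ht).trans_eq ?_
    ring
  · have := hu.energy.norm_le ht
    rw [hu.weak.initial] at this
    gcongr
  · obtain ⟨s, hs, h⟩ := hc u₀ u b hA hu hb hub t ht
    refine ⟨s, hs, h.trans ?_⟩
    have ht0 : 0 < t := by linarith
    have hI0 : 0 ≤ ∫ r in (0 : ℝ)..t, b r :=
      intervalIntegral.integral_nonneg ht0.le fun r hr => (sq_nonneg _).trans (hub r hr.1)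
    have h1 : t ^ (-(3 / 2) + σ) ≤ t ^ (-α) :=
      Real.rpow_le_rpow_of_exponent_le ht (by linarith)
    have h2 : (∫ r in (0 : ℝ)..t, b r) ^ 2 * t ^ (-(5 / 2) : ℝ) ≤ K ^ 2 * t ^ (-α) := by
      calc _ ≤ (K * t ^ γ) ^ 2 * t ^ (-(5 / 2) : ℝ) := by
            have := hI t ht
            gcongr
        _ = K ^ 2 * t ^ (2 * γ - 5 / 2) := by
            rw [mul_pow, ← Real.rpow_mul_natCast ht0.le, mul_assoc, ← Real.rpow_add ht0]
            congr 2; push_cast; ring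
        _ ≤ _ := by
            gcongr ?_ * ?_
            exact Real.rpow_le_rpow_of_exponent_le ht (by linarith)
    have h3 := rpow_neg_le_six_mul (x := t) (y := 1 + t) hα hα' (by linarith) (by linarith)
    calc _ ≤ ‖u s‖ ^ 2 / 27 + c * (A ^ 2 * t ^ (-α) + K ^ 2 * t ^ (-α)) := by gcongr
      _ = ‖u s‖ ^ 2 / 27 + c * (A ^ 2 + K ^ 2) * t ^ (-α) := by ring
      _ ≤ ‖u s‖ ^ 2 / 27 + c * (A ^ 2 + K ^ 2) * (6 * (1 + t) ^ (-α)) := by gcongr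
      _ = _ := by ring

/-- The decay rate of the energy. Three rounds suffice: boundedness of the energy gives the rate
`1 / 2`, this gives the rate `min (3 / 2 - σ) (3 / 2)`, and for `σ < 0` the energy is then
integrable in time, which gives the rate `3 / 2 - σ`. -/
lemma exists_energy_decay {σ : ℝ} (hσ : σ ∈ Icc (-1 : ℝ) 1) :
    ∃ C : ℝ → ℝ → ℝ, ∀ (u₀ : L2) (u : ℝ → L2), pmNorm σ u₀ < ⊤ → IsLerayHopf u₀ u →
      ∀ t, 0 ≤ t → ‖u t‖ ^ 2 ≤ C ‖u₀‖ (pmNorm σ u₀).toReal * (1 + t) ^ (-(3 / 2) + σ) := by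
  obtain ⟨c, hc0, hc⟩ := exists_decay_round hσ
  let next : ℝ → ℝ → ℝ → ℝ := fun N A K => 6 * N ^ 2 + c * (A ^ 2 + K ^ 2)
  have hnext : ∀ N A K, 0 ≤ next N A K := fun N A K => by positivity
  have h1t : ∀ t : ℝ, 1 ≤ t → 1 + t ≤ 2 * t := fun t ht => by linarith
  -- the rate `1 / 2`
  have round1 : ∀ (u₀ : L2) (u : ℝ → L2), pmNorm σ u₀ < ⊤ → IsLerayHopf u₀ u → ∀ t, 0 ≤ t →
      ‖u t‖ ^ 2 ≤ next ‖u₀‖ (pmNorm σ u₀).toReal (‖u₀‖ ^ 2) * (1 + t) ^ (-(1 / 2) : ℝ) := by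
    intro u₀ u hA hu
    refine hc u₀ u (fun _ => ‖u₀‖ ^ 2) (‖u₀‖ ^ 2) 1 (1 / 2) hA hu continuous_const
      (fun r hr => ?_) (fun t ht => ?_) (by norm_num) (by linarith [hσ.2]) (by norm_num)
    · have := hu.energy.norm_le hr
      rw [hu.weak.initial] at this
      gcongr
    · simp [mul_comm]
  -- the rate `α ≤ 3 / 2`
  have round2 : ∀ (u₀ : L2) (u : ℝ → L2) (α : ℝ), pmNorm σ u₀ < ⊤ → IsLerayHopf u₀ u → 0 ≤ α →
      α ≤ 3 / 2 → α ≤ 3 / 2 - σ → ∀ t, 0 ≤ t →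
      ‖u t‖ ^ 2 ≤ next ‖u₀‖ (pmNorm σ u₀).toReal
        (4 * next ‖u₀‖ (pmNorm σ u₀).toReal (‖u₀‖ ^ 2)) * (1 + t) ^ (-α) := by
    intro u₀ u α hA hu hα hα1 hα2
    set C := next ‖u₀‖ (pmNorm σ u₀).toReal (‖u₀‖ ^ 2) with hC
    have hC0 : 0 ≤ C := hnext _ _ _
    refine hc u₀ u (fun r => C * (1 + |r|) ^ (-(1 / 2) : ℝ)) (4 * C) (1 / 2) α hA hu
      (continuous_const.mul (continuous_one_add_abs_rpow _)) (fun r hr => ?_) (fun t ht => ?_) hα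
      hα2 (by linarith)
    · simp only [abs_of_nonneg hr]
      exact round1 u₀ u hA hu r hr
    · rw [intervalIntegral.integral_const_mul,
        integral_one_add_abs_rpow (by norm_num) (by linarith)]
      have e1 : (-(1 / 2) + 1 : ℝ) = 1 / 2 := by norm_num
      rw [e1, mul_comm 4 C, mul_assoc]
      refine mul_le_mul_of_nonneg_left ?_ hC0
      have h2 : (1 + t) ^ (1 / 2 : ℝ) ≤ (4 * t) ^ (1 / 2 : ℝ) :=
        Real.rpow_le_rpow (by linarith) (by linarith) (by norm_num)
      rw [Real.mul_rpow (by norm_num) (by linarith), ← Real.sqrt_eq_rpow 4,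
        show (4 : ℝ) = 2 ^ 2 by norm_num, Real.sqrt_sq zero_le_two] at h2
      linarith
  rcases le_or_gt 0 σ with h0 | h0
  · refine ⟨fun N A => next N A (4 * next N A (N ^ 2)), fun u₀ u hA hu t ht => ?_⟩
    have := round2 u₀ u (3 / 2 - σ) hA hu (by linarith [hσ.2]) (by linarith) le_rfl t ht
    rwa [show -(3 / 2 - σ) = -(3 / 2) + σ by ring] at this
  · refine ⟨fun N A => next N A (2 * next N A (4 * next N A (N ^ 2))), fun u₀ u hA hu => ?_⟩
    set C := next ‖u₀‖ (pmNorm σ u₀).toReal (4 * next ‖u₀‖ (pmNorm σ u₀).toReal (‖u₀‖ ^ 2))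
      with hC
    have hC0 : 0 ≤ C := hnext _ _ _
    have := hc u₀ u (fun r => C * (1 + |r|) ^ (-(3 / 2) : ℝ)) (2 * C) 0 (3 / 2 - σ) hA hu
      (continuous_const.mul (continuous_one_add_abs_rpow _)) (fun r hr => ?_) (fun t ht => ?_)
      (by linarith) le_rfl (by linarith [hσ.1])
    · rwa [show -(3 / 2 - σ) = -(3 / 2) + σ by ring] at this
    · simp only [abs_of_nonneg hr]
      exact round2 u₀ u (3 / 2) hA hu (by norm_num) le_rfl (by linarith) r hr
    · rw [intervalIntegral.integral_const_mul,
        integral_one_add_abs_rpow (by norm_num) (by linarith),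
        Real.rpow_zero, mul_one, mul_comm 2 C]
      refine mul_le_mul_of_nonneg_left ?_ hC0
      have h2 : 0 ≤ (1 + t) ^ (-(3 / 2) + 1 : ℝ) := Real.rpow_nonneg (by linarith) _
      rw [div_le_iff_of_neg (by norm_num)]
      linarith

lemma integral_norm_sq_mul_exp_le {T : ℝ} (ξ : R3) :
    ∫ r in (0 : ℝ)..T, ‖ξ‖ ^ 2 * Real.exp (-(T - r) * lam ξ) ≤ 1 := by
  have hd : ∀ r ∈ uIcc 0 T, HasDerivAt (fun r => Real.exp (-(T - r) * lam ξ))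
      (lam ξ * Real.exp (-(T - r) * lam ξ)) r := fun r _ => by
    have h1 : HasDerivAt (fun x => -(T - x) * lam ξ) (lam ξ) r := by
      simpa using (((hasDerivAt_id r).const_sub T).neg.mul_const (lam ξ))
    simpa [mul_comm] using h1.exp
  have h1 := intervalIntegral.integral_eq_sub_of_hasDerivAt hd
    (Continuous.intervalIntegrable (by fun_prop) _ _)
  have h2 : ∀ r, lam ξ * Real.exp (-(T - r) * lam ξ) =
      (2 * Real.pi) ^ 2 * (‖ξ‖ ^ 2 * Real.exp (-(T - r) * lam ξ)) := fun r => by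
    rw [lam]; ring
  simp only [h2, intervalIntegral.integral_const_mul, sub_self, neg_zero, zero_mul, Real.exp_zero]
    at h1
  have h3 : 1 ≤ (2 * Real.pi) ^ 2 := by nlinarith [Real.pi_gt_three]
  rw [intervalIntegral.integral_const_mul]
  by_contra! h
  nlinarith [Real.exp_pos (-(T - 0) * lam ξ)]

/-- The nonlinear contribution to the pseudo-measure norm. By Young's inequality
`|ξ|^(σ+1) w^((1-σ)/2) ≤ |ξ|² + w` with `w = (1 + r)⁻²`; the heat factor makes the first term
integrable in time. -/
lemma rpow_mul_heatPot_le {σ C T : ℝ} (hσ : σ ∈ Icc (-1 : ℝ) 1) (hC : 0 ≤ C) (hT : 0 ≤ T)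
    (ξ : R3) :
    ‖ξ‖ ^ (σ + 1) * heatPot (fun r => C * (1 + |r|) ^ (-(1 - σ))) T ξ ≤ 2 * C := by
  have hc1 := continuous_one_add_abs_rpow (-2)
  have hc2 := continuous_one_add_abs_rpow (-(1 - σ))
  have h1 : ∀ r ∈ Icc 0 T, ‖ξ‖ ^ (σ + 1) * (C * (1 + |r|) ^ (-(1 - σ)) *
      Real.exp (-(T - r) * lam ξ)) ≤
      C * (‖ξ‖ ^ 2 * Real.exp (-(T - r) * lam ξ) + (1 + |r|) ^ (-2 : ℝ)) := by
    intro r hr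
    have hr1 : 0 < 1 + |r| := by positivity
    have h2 := Real.geom_mean_le_arith_mean2_weighted (w₁ := (σ + 1) / 2) (w₂ := (1 - σ) / 2)
      (p₁ := ‖ξ‖ ^ 2) (p₂ := (1 + |r|) ^ (-2 : ℝ)) (by linarith [hσ.1]) (by linarith [hσ.2])
      (by positivity) (by positivity) (by ring)
    rw [← Real.rpow_natCast_mul (norm_nonneg _), ← Real.rpow_mul hr1.le,
      show ((2 : ℕ) : ℝ) * ((σ + 1) / 2) = σ + 1 by push_cast; ring,
      show (-2 : ℝ) * ((1 - σ) / 2) = -(1 - σ) by ring] at h2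
    have h3 : (σ + 1) / 2 * ‖ξ‖ ^ 2 ≤ ‖ξ‖ ^ 2 :=
      mul_le_of_le_one_left (by positivity) (by linarith [hσ.2])
    have h4 : (1 - σ) / 2 * (1 + |r|) ^ (-2 : ℝ) ≤ (1 + |r|) ^ (-2 : ℝ) :=
      mul_le_of_le_one_left (by positivity) (by linarith [hσ.1])
    have h5 : Real.exp (-(T - r) * lam ξ) ≤ 1 := Real.exp_le_one_iff.2
      (mul_nonpos_of_nonpos_of_nonneg (by linarith [hr.2]) (lam_nonneg ξ))
    calc _ = C * ((‖ξ‖ ^ (σ + 1) * (1 + |r|) ^ (-(1 - σ))) * Real.exp (-(T - r) * lam ξ)) := by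
          ring
      _ ≤ C * ((‖ξ‖ ^ 2 + (1 + |r|) ^ (-2 : ℝ)) * Real.exp (-(T - r) * lam ξ)) := by
          gcongr
          linarith
      _ ≤ _ := by
          rw [add_mul]
          gcongr
          exact mul_le_of_le_one_right (by positivity) h5
  rw [heatPot, ← intervalIntegral.integral_const_mul]
  refine (intervalIntegral.integral_mono_on hT (Continuous.intervalIntegrable (by fun_prop) _ _)
    (Continuous.intervalIntegrable (by fun_prop) _ _) h1).trans ?_
  rw [intervalIntegral.integral_const_mul, intervalIntegral.integral_add
    (Continuous.intervalIntegrable (by fun_prop) _ _) (hc1.intervalIntegrable _ _),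
    integral_one_add_abs_rpow (by norm_num) hT]
  have h2 := integral_norm_sq_mul_exp_le (T := T) ξ
  have h3 : ((1 + T) ^ (-2 + 1 : ℝ) - 1) / (-2 + 1) ≤ 1 := by
    have : 0 ≤ (1 + T) ^ (-2 + 1 : ℝ) := Real.rpow_nonneg (by linarith) _
    rw [div_le_iff_of_neg (by norm_num)]
    linarith
  nlinarith

/-- Propagation of the pseudo-measure norm, given decay of the energy. -/
lemma IsWeakSolution.pmNorm_le {σ C : ℝ} {u₀ : L2} {u : ℝ → L2} (hσ : σ ∈ Icc (-1 : ℝ) 1)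
    (hu : IsWeakSolution u₀ u) (hA : pmNorm σ u₀ < ⊤) (hC : 0 ≤ C)
    (hd : ∀ t, 0 ≤ t → ‖u t‖ ^ 2 ≤ C * (1 + t) ^ (-(1 - σ))) {t : ℝ} (ht : 0 ≤ t) :
    pmNorm σ (u t) ≤ ENNReal.ofReal (6 * (pmNorm σ u₀).toReal + 72 * Real.pi * C) := by
  have h0 : ∀ᵐ ξ : R3, ξ ≠ 0 := by simp [ae_iff, measure_singleton]
  refine pmNorm_le_of_ae ?_
  filter_upwards [h0, hu.ae_norm_hat_le (b := fun r => C * (1 + |r|) ^ (-(1 - σ)))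
    (continuous_const.mul (continuous_one_add_abs_rpow _))
    (fun r hr => by simpa only [abs_of_nonneg hr] using hd r hr) ht,
    ae_norm_hat_le_of_pmNorm hA] with ξ hξ h1 h2
  set A := (pmNorm σ u₀).toReal
  have hpos : 0 < ‖ξ‖ := norm_pos_iff.2 hξ
  have h3 := rpow_mul_heatPot_le hσ hC ht ξ
  rw [Real.rpow_add_one hpos.ne'] at h3
  have h4 : Real.exp (-t * lam ξ) ≤ 1 := Real.exp_le_one_iff.2
    (mul_nonpos_of_nonpos_of_nonneg (by linarith) (lam_nonneg ξ))
  have h5 : ‖ξ‖ ^ σ * (A * ‖ξ‖ ^ (-σ)) = A := by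
    rw [Real.rpow_neg hpos.le]
    have := (Real.rpow_pos_of_pos hpos σ).ne'
    field_simp
  have hA0 : 0 ≤ A := ENNReal.toReal_nonneg
  calc _ ≤ ‖ξ‖ ^ σ * (6 * (1 * (A * ‖ξ‖ ^ (-σ))) + 36 * Real.pi * (‖ξ‖ *
        heatPot (fun r => C * (1 + |r|) ^ (-(1 - σ))) t ξ)) := by
        gcongr
        refine h1.trans ?_
        gcongr
    _ = 6 * (‖ξ‖ ^ σ * (A * ‖ξ‖ ^ (-σ))) + 36 * Real.pi * (‖ξ‖ ^ σ * ‖ξ‖ *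
        heatPot (fun r => C * (1 + |r|) ^ (-(1 - σ))) t ξ) := by ring
    _ ≤ 6 * A + 36 * Real.pi * (2 * C) := by
        rw [h5]
        gcongr
    _ = _ := by ring

end NSE

end

theorem theorem1 (σ : ℝ) (hσ : σ ∈ Set.Icc (-1 : ℝ) 1) :
    ∃ C : ℝ → ℝ → ℝ, ∀ (u₀ : NSE.L2) (u : ℝ → NSE.L2),
      NSE.pmNorm σ u₀ < ⊤ → NSE.WeaklyDivFree u₀ → NSE.IsLerayHopf u₀ u →
      ∀ t : ℝ, 0 ≤ t →
        ‖u t‖ ≤ C ‖u₀‖ (NSE.pmNorm σ u₀).toReal ∧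
        NSE.pmNorm σ (u t) ≤ ENNReal.ofReal (C ‖u₀‖ (NSE.pmNorm σ u₀).toReal) ∧
        ‖u t‖ ^ 2 ≤ C ‖u₀‖ (NSE.pmNorm σ u₀).toReal * (1 + t) ^ (-(3 / 2 : ℝ) + σ) := by
  obtain ⟨C, hC⟩ := NSE.exists_energy_decay hσ
  refine ⟨fun N A => N + (6 * A + 72 * Real.pi * |C N A|) + |C N A|,
    fun u₀ u hA _ hu t ht => ?_⟩
  set N := ‖u₀‖
  set A := (NSE.pmNorm σ u₀).toReal with hAdef
  have hN : 0 ≤ N := norm_nonneg _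
  have hA0 : 0 ≤ A := ENNReal.toReal_nonneg
  have hD0 : 0 ≤ |C N A| := abs_nonneg _
  have hdecay : ∀ t, 0 ≤ t → ‖u t‖ ^ 2 ≤ |C N A| * (1 + t) ^ (-(3 / 2 : ℝ) + σ) := fun t ht =>
    (hC u₀ u hA hu t ht).trans
      (mul_le_mul_of_nonneg_right (le_abs_self _) (Real.rpow_nonneg (by linarith) _))
  have hpi : 0 ≤ 72 * Real.pi * |C N A| := by positivity
  refine ⟨?_, ?_, ?_⟩
  · have := hu.energy.norm_le ht
    rw [hu.weak.initial] at this
    simp only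
    linarith
  · refine (hu.weak.pmNorm_le hσ hA hD0 (fun t ht => (hdecay t ht).trans ?_) ht).trans
      (ENNReal.ofReal_le_ofReal ?_)
    · gcongr
      · linarith
      · linarith
    · simp only
      linarith
  · refine (hdecay t ht).trans (mul_le_mul_of_nonneg_right ?_ (Real.rpow_nonneg (by linarith) _))
    simp only
    linarith
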